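/- **Setting.** Let $G$ be a graph on areas $1,\dots,I$ with adjacency matrix $(g_{ij})\in\{0,1\}^{I\times I}$ (symmetric, zero diagonal), let $H\ge 2$, and let $N_1,\dots,N_I\ge 0$ be the numbers of observations. For $b>0$ and $c\in\mathbb R$, $PG(b,c)$ is the law of $\frac1{2\pi^2}\sum_{k\ge1}\frac{g_k}{(k-1/2)^2+c^2/(4\pi^2)}$ with $g_k$ i.i.d. $\mathrm{Gamma}(b,1)$. Consider the following model. The hyperparameters $\rho\in(0,1)$, $\Sigma\in\mathbb R^{(H-1)\times(H-1)}$ positive definite, and $(\widetilde m_C)_C$ with $\widetilde m_C\in\mathbb R^{H-1}$ for each connected component $C$ of $G$, have an arbitrary joint prior; put $\widetilde m_i=\widetilde m_C$ for $i\in C$, $f_i=\rho\sum_j g_{ij}+1-\rho$ and $F=\mathrm{diag}(f_1,\dots,f_I)$. Given these, $\widetilde w=(\widetilde w_1,\dots,\widetilde w_I)$, $\widetilde w_i\in\mathbb R^{H-1}$, has law $\mathcal N\big(\widetilde m,((F-\rho G)\otimes\Sigma^{-1})^{-1}\big)$. The allocations $s_{ij}\in\{1,\dots,H\}$, $j\le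 N_i$, are conditionally independent given $\widetilde w$ with $P(s_{ij}=k\mid\widetilde w)=e^{\widetilde w_{ik}}/\sum_{l=1}^H e^{\widetilde w_{il}}$, where $\widetilde w_{iH}:=0$. The atoms $\tau_1,\dots,\tau_H$ (mean and variance) are i.i.d. from a probability $P_0$ on $\mathbb R\times(0,\infty)$, independent of the variables above, and the data $y_{ij}$ are conditionally independent given the rest with $y_{ij}\sim\mathcal N(\tau_{s_{ij}})$. Fix an area $i$ with $N_i\ge1$ and $h\in\{1,\dots,H-1\}$. Let $N_{ih}=\#\{j:s_{ij}=h\}$, $C_{ih}=\log\sum_{k\ne h,\,k\le H}e^{\widetilde w_{ik}}$, $\eta_{ih}=\widetilde w_{ih}-C_{ih}$, and $$\mu_i=\frac{\rho\sum_j g_{ij}\widetilde w_j+(1-\rho)\widetilde m_i}{f_i},\qquad \mu^*_{ih}=\mu_{ih}+\Sigma_{h,-h}\Sigma_{-h,-h}^{-1}(\widetilde w_{i,-h}-\mu_{i,-h}),\qquad \Sigma^*_{ih}=\frac{\Sigma_{hh}-\Sigma_{h,-h}\Sigma_{-h,-h}^{-1}\Sigma_{-h,h}}{f_i},$$ where an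 index $-h$ means that the $h$-th entry, row or column is removed. The augmented model has one more variable $\omega_{ih}$: its joint law is obtained from the joint law of the model by multiplying by $PG(N_i,0)(d\omega_{ih})$ and replacing the likelihood factor $$\Big(\frac{e^{\eta_{ih}}}{1+e^{\eta_{ih}}}\Big)^{N_{ih}}\Big(\frac1{1+e^{\eta_{ih}}}\Big)^{N_i-N_{ih}}\quad\text{by}\quad 2^{-N_i}e^{(N_{ih}-N_i/2)\eta_{ih}}e^{-\omega_{ih}\eta_{ih}^2/2}.$$ **Claim.** In the augmented model: 1. The joint law of $(\rho,\Sigma,\widetilde m,\widetilde w,s,\tau,y)$ is that of the original model. 2. The conditional law of $\widetilde w_{ih}$ given $\omega_{ih}$ and all the other variables is almost surely $\mathcal N(\hat\mu_{ih},\hat\Sigma_{ih})$, where $$\hat\Sigma_{ih}=\Big(\frac1{\Sigma^*_{ih}}+\omega_{ih}\Big)^{-1},\qquad \hat\mu_{ih}=\Big(\frac{\mu^*_{ih}}{\Sigma^*_{ih}}+N_{ih}-\frac{N_i}2+\omega_{ih}C_{ih}\Big)\hat\Sigma_{ih};$$ the same is true given only $\rho$, $\Sigma$, $\widetilde m$,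 the entries of $\widetilde w$ other than $\widetilde w_{ih}$, $s_i=(s_{i1},\dots,s_{iN_i})$ and $\omega_{ih}$. 3. The conditional law of $\omega_{ih}$ given all the other variables is almost surely $PG\big(N_i,\widetilde w_{ih}-\log\sum_{k\ne h}e^{\widetilde w_{ik}}\big)$; the same is true given only $\widetilde w_i$. 4. Consequently the two-step Gibbs update is exact, without a Metropolis–Hastings correction: for almost every value of all variables of the original model other than $\widetilde w_{ih}$, data included, if $\widetilde w_{ih}$ is drawn from its full conditional law in the original model, then $\omega\sim PG(N_i,\widetilde w_{ih}-C_{ih})$ is drawn, and then a new value is drawn from $\mathcal N(\hat\mu_{ih},\hat\Sigma_{ih})$ (computed with $\omega$), the new value again has that full conditional law. -/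

import Mathlib

open MeasureTheory ProbabilityTheory
open scoped NNReal ENNReal Matrix Kronecker

noncomputable section

/-- The Pólya–Gamma distribution `PG(b, c)`, `b > 0`, `c` real: the law of
`(1 / (2π²)) ∑_{k ≥ 1} g_k / ((k - 1/2)² + c² / (4π²))` with `g_1, g_2, …` i.i.d. `Gamma(b, 1)`.
The sum is indexed from `0`, so that `k + 1` plays the role of `k`. -/
def polyaGamma (b c : ℝ) : Measure ℝ :=
  (Measure.infinitePi fun _ : ℕ => gammaMeasure b 1).map fun g : ℕ → ℝ =>
    1 / (2 * Real.pi ^ 2) *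
      ∑' k : ℕ, g k / (((k : ℝ) + 1 - 1 / 2) ^ 2 + c ^ 2 / (4 * Real.pi ^ 2))

/-! The mixture has `H = d + 1` components, indexed by `Fin (d + 1)`; the last one is the reference
component of the additive log-ratio transform. Transformed weights of one area are vectors
`v : Fin d → ℝ`. -/

/-- `(ṽ_1, …, ṽ_{H-1}, ṽ_H)` with the convention `ṽ_H = 0`. -/
def extWeight {d : ℕ} (v : Fin d → ℝ) : Fin (d + 1) → ℝ :=
  Fin.snoc (α := fun _ => ℝ) v 0

/-- The inverse additive log-ratio transform `ℝ^{H-1} → S^H`. -/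
def alrInv {d : ℕ} (v : Fin d → ℝ) (k : Fin (d + 1)) : ℝ :=
  Real.exp (extWeight v k) / (1 + ∑ l, Real.exp (v l))

/-- `C_h = log ∑_{k ≠ h} exp(ṽ_k)`, where `k` runs over all `H` components other than `h`. -/
def offset {d : ℕ} (h : Fin d) (v : Fin d → ℝ) : ℝ :=
  Real.log (∑ k ∈ Finset.univ.erase h.castSucc, Real.exp (extWeight v k))

/-- The number of observations of an area (with allocations `s`) allocated to component `h`. -/
def allocCount {n d : ℕ} (h : Fin d) (s : Fin n → Fin (d + 1)) : ℕ :=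
  (Finset.univ.filter fun j => s j = h.castSucc).card

section MCAR

variable {I : ℕ} (G : SimpleGraph (Fin I)) [DecidableRel G.Adj]

/-- `ρ ∑_j g_ij + 1 - ρ`. -/
def carScale (ρ : ℝ) (i : Fin I) : ℝ :=
  ρ * ∑ j, G.adjMatrix ℝ i j + 1 - ρ

/-- The precision matrix `(F - ρ G) ⊗ Σ⁻¹` of the MCAR distribution. -/
def mcarPrecision {d : ℕ} (ρ : ℝ) (S : Matrix (Fin d) (Fin d) ℝ) :
    Matrix (Fin I × Fin d) (Fin I × Fin d) ℝ :=
  (Matrix.diagonal (carScale G ρ) - ρ • G.adjMatrix ℝ) ⊗ₖ S⁻¹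

/-- The means `m̃_1, …, m̃_I`, common within each connected component of the graph. -/
def areaMean {d : ℕ} (m : G.ConnectedComponent → Fin d → ℝ) (i : Fin I) : Fin d → ℝ :=
  m (G.connectedComponentMk i)

/-- The Lebesgue density of `vec(w̃_1, …, w̃_I) ∼ N(m̃, ((F - ρ G) ⊗ Σ⁻¹)⁻¹)`. -/
def mcarPDF {d : ℕ} (ρ : ℝ) (S : Matrix (Fin d) (Fin d) ℝ) (m : G.ConnectedComponent → Fin d → ℝ)
    (w : Fin I → Fin d → ℝ) : ℝ :=
  let Q := mcarPrecision G ρ S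
  let x : Fin I × Fin d → ℝ := fun p => w p.1 p.2 - areaMean G m p.1 p.2
  Real.sqrt (Q.det / (2 * Real.pi) ^ (I * d)) * Real.exp (-(x ⬝ᵥ (Q *ᵥ x)) / 2)

/-- `μ_i = (ρ ∑_j g_ij w̃_j + (1 - ρ) m̃_i) / (ρ ∑_j g_ij + 1 - ρ)`. -/
def condMean {d : ℕ} (ρ : ℝ) (m : G.ConnectedComponent → Fin d → ℝ) (w : Fin I → Fin d → ℝ)
    (i : Fin I) (k : Fin d) : ℝ :=
  (ρ * ∑ j, G.adjMatrix ℝ i j * w j k + (1 - ρ) * areaMean G m i k) / carScale G ρ i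

/-- `μ*_ih = μ_ih + Σ_{h,-h} Σ_{-h,-h}⁻¹ (w̃_{i,-h} - μ_{i,-h})`. -/
def muStar {d : ℕ} (ρ : ℝ) (S : Matrix (Fin d) (Fin d) ℝ) (m : G.ConnectedComponent → Fin d → ℝ)
    (w : Fin I → Fin d → ℝ) (i : Fin I) (h : Fin d) : ℝ :=
  condMean G ρ m w i h +
    (fun k : {k // k ≠ h} => S h k) ⬝ᵥ
      ((S.submatrix (Subtype.val : {k // k ≠ h} → Fin d) Subtype.val)⁻¹ *ᵥ
        fun k : {k // k ≠ h} => w i k - condMean G ρ m w i k)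

/-- `Σ*_ih = (ρ ∑_j g_ij + 1 - ρ)⁻¹ (Σ_hh - Σ_{h,-h} Σ_{-h,-h}⁻¹ Σ_{-h,h})`. -/
def sigmaStar {d : ℕ} (ρ : ℝ) (S : Matrix (Fin d) (Fin d) ℝ) (i : Fin I) (h : Fin d) : ℝ :=
  (carScale G ρ i)⁻¹ *
    (S h h - (fun k : {k // k ≠ h} => S h k) ⬝ᵥ
      ((S.submatrix (Subtype.val : {k // k ≠ h} → Fin d) Subtype.val)⁻¹ *ᵥ
        fun k : {k // k ≠ h} => S k h))

/-- The variance `Σ̂_ih = (1 / Σ*_ih + ω)⁻¹`. -/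
def sigmaHat {d : ℕ} (ρ : ℝ) (S : Matrix (Fin d) (Fin d) ℝ) (i : Fin I) (h : Fin d)
    (ω : ℝ) : ℝ :=
  (1 / sigmaStar G ρ S i h + ω)⁻¹

/-- The mean `μ̂_ih = (μ*_ih / Σ*_ih + N_ih - N_i / 2 + ω C_ih) (1 / Σ*_ih + ω)⁻¹`. It does not
involve the entry `w i h`. -/
def muHat {d : ℕ} (ρ : ℝ) (S : Matrix (Fin d) (Fin d) ℝ) (m : G.ConnectedComponent → Fin d → ℝ)
    (w : Fin I → Fin d → ℝ) (i : Fin I) (h : Fin d) {n : ℕ} (s : Fin n → Fin (d + 1))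
    (ω : ℝ) : ℝ :=
  (muStar G ρ S m w i h / sigmaStar G ρ S i h + allocCount h s - n / 2 + ω * offset h (w i)) *
    (1 / sigmaStar G ρ S i h + ω)⁻¹

/-- The law `N(μ̂_ih, Σ̂_ih)`. -/
def gaussHat {d : ℕ} (ρ : ℝ) (S : Matrix (Fin d) (Fin d) ℝ) (m : G.ConnectedComponent → Fin d → ℝ)
    (w : Fin I → Fin d → ℝ) (i : Fin I) (h : Fin d) {n : ℕ} (s : Fin n → Fin (d + 1))
    (ω : ℝ) : Measure ℝ :=
  gaussianReal (muHat G ρ S m w i h s ω) (sigmaHat G ρ S i h ω).toNNReal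

/-- One two-step update of the current value `v` of `w̃_ih`, all the rest being fixed: draw
`ω ∼ PG(N_i, v - C_ih)`, then draw the new value from `N(μ̂_ih, Σ̂_ih)`. -/
def twoStepUpdate {d : ℕ} (ρ : ℝ) (S : Matrix (Fin d) (Fin d) ℝ)
    (m : G.ConnectedComponent → Fin d → ℝ) (w : Fin I → Fin d → ℝ) (i : Fin I) (h : Fin d)
    {n : ℕ} (s : Fin n → Fin (d + 1)) (v : ℝ) : Measure ℝ :=
  (polyaGamma n (v - offset h (w i))).bind fun ω => gaussHat G ρ S m w i h s ω

/-- The hyperparameters `(ρ, Σ, (m̃_C)_C)`, `C` ranging over the connected components. -/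
abbrev Hyper (d : ℕ) : Type :=
  ℝ × (Fin d → Fin d → ℝ) × (G.ConnectedComponent → Fin d → ℝ)

/-- All unknowns and the data: `((ρ, Σ, m̃), w̃, s, τ, y)`, with `τ_h` the mean and the variance of
the `h`-th Gaussian kernel. -/
abbrev ModelState (d : ℕ) (N : Fin I → ℕ) : Type :=
  Hyper G d × (Fin I → Fin d → ℝ) × ((i : Fin I) → Fin (N i) → Fin (d + 1)) ×
    (Fin (d + 1) → ℝ × ℝ≥0) × ((i : Fin I) → Fin (N i) → ℝ)

/-- The joint law of the spatial mixture model: `(ρ, Σ, m̃) ∼ prior`,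
`w̃ ∣ ρ, Σ, m̃ ∼ N(m̃, ((F - ρ G) ⊗ Σ⁻¹)⁻¹)`, `τ_h` i.i.d. `P₀`,
`P(s_ij = k ∣ w̃) = alr⁻¹(w̃_i)_k` independently, and `y_ij ∣ s, τ ∼ N(τ_{s_ij})` independently. -/
def modelLaw {d : ℕ} (N : Fin I → ℕ) (prior : Measure (Hyper G d)) (P₀ : Measure (ℝ × ℝ≥0)) :
    Measure (ModelState G d N) :=
  (prior.prod (volume.prod (Measure.count.prod ((Measure.pi fun _ => P₀).prod volume)))).withDensity
    fun ((ρ, S, m), w, s, τ, y) => ENNReal.ofReal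
      (mcarPDF G ρ (Matrix.of S) m w * (∏ i, ∏ j, alrInv (w i) (s i j)) *
        ∏ i, ∏ j, gaussianPDFReal (τ (s i j)).1 (τ (s i j)).2 (y i j))

/-- The likelihood of `w̃_ih` given the allocations and `w̃_{i,-h}`, as a function of
`η = η_ih`, with `a = N_ih` and `b = N_i`. -/
def logisticLik (a b : ℕ) (η : ℝ) : ℝ :=
  (Real.exp η / (1 + Real.exp η)) ^ a * (1 / (1 + Real.exp η)) ^ (b - a)

/-- The integrand, against `PG(b, 0)(dω)`, in the Pólya–Gamma representation of
`logisticLik a b η`. -/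
def pgFactor (a b : ℕ) (η ω : ℝ) : ℝ :=
  ((2 : ℝ) ^ b)⁻¹ * Real.exp ((a - b / 2) * η) * Real.exp (-ω * η ^ 2 / 2)

/-- The joint law of the model augmented by `ω_ih`: the base measure gets the extra factor
`PG(N_i, 0)(dω)`, and in the joint density the factor `logisticLik` is replaced by `pgFactor`. -/
def augmentedLaw {d : ℕ} (N : Fin I → ℕ) (prior : Measure (Hyper G d)) (P₀ : Measure (ℝ × ℝ≥0))
    (i : Fin I) (h : Fin d) : Measure (ModelState G d N × ℝ) :=
  ((modelLaw G N prior P₀).prod (polyaGamma (N i) 0)).withDensity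
    fun ((_, w, s, _, _), ω) => ENNReal.ofReal
      (pgFactor (allocCount h (s i)) (N i) (w i h - offset h (w i)) ω /
        logisticLik (allocCount h (s i)) (N i) (w i h - offset h (w i)))

end MCAR

/-- All the transformed weights except `w̃_ih`, that is `(w̃_{-i}, w̃_{i,-h})`. -/
def otherWeights {I d : ℕ} (i : Fin I) (h : Fin d) (w : Fin I → Fin d → ℝ) :
    {p : Fin I × Fin d // p ≠ (i, h)} → ℝ :=
  fun p => w p.1.1 p.1.2

end

/-! The crux is that `PG(b, c)` is an exponential tilt of `PG(b, 0)`, with density `cosh(c/2)^b *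
exp(-c² x / 2)` (`polyaGamma_eq_withDensity`). The Laplace transform of the defining gamma series is
an infinite product, which the Weierstrass product of `cosh` evaluates as `(cosh(c/2) / cosh(√(c² +
2l)/2))^b`. The tilted measure has the same transform, and Laplace transforms determine finite
measures on the nonnegative reals.

Since `1 + e^η = 2 e^{η/2} cosh(η/2)`, the quotient of the augmented by the logistic likelihood
factor is exactly this density at `c = η` (`pgFactor_div_logisticLik`). So the augmented law is the
model law followed by the Markov kernel `PG(N_i, η_ih)`: its marginal is the original model, and the
kernel is the conditional law of `ω_ih`.

As a function of `w̃_ih`, the augmented log-density is quadratic. The MCAR prior contributes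
`-(w̃_ih - μ*)² / (2Σ*)` up to a constant, by a Schur complement and because neighbouring areas
share their mean. The allocations and `ω` contribute `(N_ih - N_i/2) η - ω η² / 2` with `η = w̃_ih -
C_ih`, and `C_ih` is free of `w̃_ih`. Completing the square gives the Gaussian
(`weightDensity_mul_gaussianPDFReal`).

Both facts are identities of joint laws, from which conditional laws follow by uniqueness of
disintegration; a kernel that depends on fewer variables is also the conditional law given those
alone (`map_eq_compProd_of_comap`). The two-step update redraws `ω` and then `w̃_ih` from their
conditional laws, so it preserves the law of `w̃_ih` jointly with the rest, hence its conditional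
law (`condDistrib_bind_twoStep`). -/

/-! ### Weierstrass products of hyperbolic functions -/

open Filter Topology in
/-- The Weierstrass product of the hyperbolic sine. -/
theorem tendsto_sinh_prod (t : ℝ) :
    Tendsto (fun n : ℕ => t * ∏ j ∈ Finset.range n, (1 + t ^ 2 / (Real.pi ^ 2 * ((j : ℝ) + 1) ^ 2)))
      atTop (𝓝 (Real.sinh t)) := by
  -- Euler's sine product on the imaginary axis: `sin(it) = i sinh t`, so the imaginary part is the
  -- real statement.
  have key := Complex.tendsto_euler_sin_prod (t / Real.pi * Complex.I)
  have hpi : (Real.pi : ℂ) ≠ 0 := by exact_mod_cast Real.pi_ne_zero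
  have e1 : (Real.pi : ℂ) * (t / Real.pi * Complex.I) = t * Complex.I := by field_simp
  rw [e1, Complex.sin_mul_I] at key
  have key2 := (Complex.continuous_im.tendsto _).comp key
  rw [Complex.mul_I_im, ← Complex.ofReal_sinh, Complex.ofReal_re] at key2
  refine key2.congr fun n => ?_
  have e2 : (∏ j ∈ Finset.range n, (1 - (t / Real.pi * Complex.I) ^ 2 / ((j : ℂ) + 1) ^ 2) : ℂ) =
      ((∏ j ∈ Finset.range n, (1 + t ^ 2 / (Real.pi ^ 2 * ((j : ℝ) + 1) ^ 2)) : ℝ) : ℂ) := by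
    push_cast
    refine Finset.prod_congr rfl fun j _ => ?_
    rw [mul_pow, Complex.I_sq, div_pow, mul_neg_one, neg_div, sub_neg_eq_add, div_div]
  simp only [Function.comp_apply]
  rw [e2, mul_right_comm, ← Complex.ofReal_mul, Complex.mul_I_im, Complex.ofReal_re]

open Filter Topology in
/-- The Weierstrass product of the hyperbolic cosine. -/
theorem tendsto_cosh_prod (t : ℝ) :
    Tendsto (fun n : ℕ => ∏ k ∈ Finset.range n,
      (1 + t ^ 2 / (4 * Real.pi ^ 2) / ((k : ℝ) + 1 - 1 / 2) ^ 2))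
      atTop (𝓝 (Real.cosh (t / 2))) := by
  rcases eq_or_ne t 0 with rfl | ht
  · simp
  -- `cosh(t/2) = sinh t / (2 sinh(t/2))`. Partial products of even length `2n` are taken so that
  -- the factors with `j + 1` even are exactly the first `n` factors for `sinh(t/2)`; those with `j
  -- + 1` odd remain and form the product for `cosh`.
  have h1 := (tendsto_sinh_prod t).comp
    (tendsto_id.const_mul_atTop' (two_pos : (0 : ℕ) < 2))
  have h2 := tendsto_sinh_prod (t / 2)
  have hs : Real.sinh (t / 2) ≠ 0 := by
    rw [Ne, Real.sinh_eq_zero]; simpa using ht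
  have hc : Real.sinh t / (2 * Real.sinh (t / 2)) = Real.cosh (t / 2) := by
    have : Real.sinh t = 2 * Real.sinh (t / 2) * Real.cosh (t / 2) := by
      rw [← Real.sinh_two_mul]; congr 1; ring
    rw [this]; field_simp
  rw [← hc]
  refine (h1.div (h2.const_mul 2) (by simpa using hs)).congr fun n => ?_
  have split : ∀ n : ℕ, ∏ j ∈ Finset.range (2 * n),
      (1 + t ^ 2 / (Real.pi ^ 2 * ((j : ℝ) + 1) ^ 2)) =
      (∏ k ∈ Finset.range n, (1 + t ^ 2 / (4 * Real.pi ^ 2) / ((k : ℝ) + 1 - 1 / 2) ^ 2)) *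
      ∏ j ∈ Finset.range n, (1 + (t / 2) ^ 2 / (Real.pi ^ 2 * ((j : ℝ) + 1) ^ 2)) := by
    intro n
    induction n with
    | zero => simp
    | succ n ih =>
      rw [show 2 * (n + 1) = 2 * n + 1 + 1 by ring, Finset.prod_range_succ, Finset.prod_range_succ,
        ih, Finset.prod_range_succ, Finset.prod_range_succ]
      have e1 : t ^ 2 / (Real.pi ^ 2 * (((2 * n : ℕ) : ℝ) + 1) ^ 2) =
          t ^ 2 / (4 * Real.pi ^ 2) / ((n : ℝ) + 1 - 1 / 2) ^ 2 := by
        rw [div_div]; congr 1; push_cast; ring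
      have e2 : t ^ 2 / (Real.pi ^ 2 * (((2 * n + 1 : ℕ) : ℝ) + 1) ^ 2) =
          (t / 2) ^ 2 / (Real.pi ^ 2 * ((n : ℝ) + 1) ^ 2) := by
        rw [div_pow, div_div]; congr 1; push_cast; ring
      rw [e1, e2]; ring
  have hne : ∏ j ∈ Finset.range n, (1 + (t / 2) ^ 2 / (Real.pi ^ 2 * ((j : ℝ) + 1) ^ 2)) ≠ 0 :=
    (Finset.prod_pos fun j _ => by positivity).ne'
  simp only [Pi.div_apply, Function.comp_apply, id_eq]
  rw [split n]
  generalize ∏ j ∈ Finset.range n, (1 + (t / 2) ^ 2 / (Real.pi ^ 2 * ((j : ℝ) + 1) ^ 2)) = B at hne ⊢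
  rw [div_eq_iff (mul_ne_zero two_ne_zero (mul_ne_zero (by simpa using ht) hne))]
  ring

/-! ### Gamma variables and their series -/

theorem ae_nonneg_gammaMeasure (a r : ℝ) : ∀ᵐ x ∂gammaMeasure a r, 0 ≤ x := by
  rw [ae_iff]
  simp only [not_le]
  change gammaMeasure a r (Set.Iio 0) = 0
  rw [gammaMeasure, withDensity_apply _ (measurableSet_Iio (a := (0 : ℝ)))]
  exact lintegral_gammaPDF_of_nonpos le_rfl

theorem measurable_gammaPDF (a r : ℝ) : Measurable (gammaPDF a r) :=
  (measurable_gammaPDFReal a r).ennreal_ofReal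

/-- The Laplace transform of the gamma distribution. -/
theorem lintegral_exp_neg_gammaMeasure {b l : ℝ} (hb : 0 < b) (hl : 0 ≤ l) :
    ∫⁻ x, ENNReal.ofReal (Real.exp (-(l * x))) ∂gammaMeasure b 1 =
      ENNReal.ofReal ((1 + l) ^ (-b)) := by
  have hl' : 0 < 1 + l := by linarith
  rw [gammaMeasure, lintegral_withDensity_eq_lintegral_mul _ (measurable_gammaPDF _ _)
    (by fun_prop)]
  -- Tilting `Gamma(b, 1)` by `e^{-lx}` gives a multiple of the `Gamma(b, 1 + l)` density, whose
  -- total mass is known.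
  have : ∀ x, (gammaPDF b 1 * fun x => ENNReal.ofReal (Real.exp (-(l * x)))) x =
      ENNReal.ofReal ((1 + l) ^ (-b)) * gammaPDF b (1 + l) x := by
    intro x
    simp only [Pi.mul_apply, gammaPDF]
    rw [← ENNReal.ofReal_mul (gammaPDFReal_nonneg hb one_pos x),
      ← ENNReal.ofReal_mul (Real.rpow_nonneg hl'.le _)]
    congr 1
    unfold gammaPDFReal
    split_ifs
    · rw [Real.rpow_neg hl'.le, Real.one_rpow, show -((1 + l) * x) = -(1 * x) + -(l * x) by ring,
        Real.exp_add]
      have := (Real.rpow_pos_of_pos hl' b).ne'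
      field_simp
    · simp
  simp_rw [this]
  rw [lintegral_const_mul _ (measurable_gammaPDF _ _), lintegral_gammaPDF_eq_one hb hl', mul_one]

/-- The mean of the gamma distribution with unit rate. -/
theorem lintegral_ofReal_gammaMeasure {b : ℝ} (hb : 0 < b) :
    ∫⁻ x, ENNReal.ofReal x ∂gammaMeasure b 1 = ENNReal.ofReal b := by
  rw [gammaMeasure, lintegral_withDensity_eq_lintegral_mul _ (measurable_gammaPDF _ _)
    (by fun_prop)]
  have : ∀ x, (gammaPDF b 1 * fun x => ENNReal.ofReal x) x =
      ENNReal.ofReal b * gammaPDF (b + 1) 1 x := by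
    intro x
    simp only [Pi.mul_apply, gammaPDF]
    rw [← ENNReal.ofReal_mul (gammaPDFReal_nonneg hb one_pos x), ← ENNReal.ofReal_mul hb.le]
    congr 1
    unfold gammaPDFReal
    split_ifs with hx
    · have hG := (Real.Gamma_pos_of_pos hb).ne'
      have hxb : x ^ (b - 1) * x = x ^ b := by
        rcases hx.eq_or_lt with rfl | hx
        · simp [Real.zero_rpow hb.ne']
        · rw [← Real.rpow_add_one hx.ne']; congr 1; ring
      rw [Real.Gamma_add_one hb.ne', Real.one_rpow, Real.one_rpow, add_sub_cancel_right, ← hxb]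
      field_simp
    · simp
  simp_rw [this]
  rw [lintegral_const_mul _ (measurable_gammaPDF _ _),
    lintegral_gammaPDF_eq_one (by linarith) one_pos, mul_one]

/-- A nonnegative random series with summable coefficients converges almost surely when the terms
are i.i.d. gamma variables. -/
theorem ae_summable_infinitePi_gammaMeasure {b : ℝ} (hb : 0 < b) {a : ℕ → ℝ} (ha : ∀ k, 0 ≤ a k)
    (hs : Summable a) :
    ∀ᵐ g ∂Measure.infinitePi fun _ : ℕ => gammaMeasure b 1,
      (∀ k, 0 ≤ g k) ∧ Summable fun k => a k * g k := by
  have : IsProbabilityMeasure (gammaMeasure b 1) := isProbabilityMeasure_gammaMeasure hb one_pos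
  have hnn : ∀ᵐ g ∂Measure.infinitePi fun _ : ℕ => gammaMeasure b 1, ∀ k, 0 ≤ g k := by
    rw [ae_all_iff]
    intro k
    have := measurePreserving_eval_infinitePi (fun _ : ℕ => gammaMeasure b 1) k
    exact this.quasiMeasurePreserving.ae (ae_nonneg_gammaMeasure b 1)
  -- The expected sum is `b ∑ a_k < ∞`, so the sum is almost surely finite.
  have hfin : ∫⁻ g, ∑' k, ENNReal.ofReal (a k) * ENNReal.ofReal (g k)
      ∂(Measure.infinitePi fun _ : ℕ => gammaMeasure b 1) ≠ ∞ := by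
    rw [lintegral_tsum fun k => Measurable.aemeasurable (by fun_prop)]
    have : ∀ k, ∫⁻ g, ENNReal.ofReal (a k) * ENNReal.ofReal (g k)
        ∂(Measure.infinitePi fun _ : ℕ => gammaMeasure b 1) = ENNReal.ofReal (a k * b) := by
      intro k
      rw [lintegral_const_mul _ (by fun_prop), ENNReal.ofReal_mul (ha k),
        ← lintegral_ofReal_gammaMeasure hb,
        ← (measurePreserving_eval_infinitePi (fun _ : ℕ => gammaMeasure b 1) k).lintegral_comp
          (by fun_prop)]
    simp_rw [this]
    exact (hs.mul_right b).tsum_ofReal_ne_top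
  filter_upwards [hnn, ae_lt_top (by fun_prop) hfin] with g hg hlt
  refine ⟨hg, ?_⟩
  have : (fun k => a k * g k) =
      fun k => (ENNReal.ofReal (a k) * ENNReal.ofReal (g k)).toReal := by
    funext k
    rw [← ENNReal.ofReal_mul (ha k), ENNReal.toReal_ofReal (mul_nonneg (ha k) (hg k))]
  rw [this]
  exact ENNReal.summable_toReal hlt.ne

open Filter Topology in
/-- The Laplace transform of a series of i.i.d. gamma variables is the limit of the products of
the Laplace transforms of its terms. -/
theorem tendsto_prod_lintegral_exp_neg_tsum {b : ℝ} (hb : 0 < b) {a : ℕ → ℝ} (ha : ∀ k, 0 ≤ a k)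
    (hs : Summable a) :
    Tendsto (fun n : ℕ => ENNReal.ofReal (∏ k ∈ Finset.range n, (1 + a k) ^ (-b))) atTop
      (𝓝 (∫⁻ g, ENNReal.ofReal (Real.exp (-∑' k, a k * g k))
        ∂(Measure.infinitePi fun _ : ℕ => gammaMeasure b 1))) := by
  have : IsProbabilityMeasure (gammaMeasure b 1) := isProbabilityMeasure_gammaMeasure hb one_pos
  have hsum := ae_summable_infinitePi_gammaMeasure hb ha hs
  have hfin : ∀ n : ℕ, ∫⁻ g, ENNReal.ofReal (Real.exp (-∑ k ∈ Finset.range n, a k * g k))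
        ∂(Measure.infinitePi fun _ : ℕ => gammaMeasure b 1) =
      ENNReal.ofReal (∏ k ∈ Finset.range n, (1 + a k) ^ (-b)) := by
    intro n
    have hind := iIndepFun_infinitePi (P := fun _ : ℕ => gammaMeasure b 1)
      (X := fun k x => ENNReal.ofReal (Real.exp (-(a k * x)))) (fun k => by fun_prop)
    have := lintegral_prod_eq_prod_lintegral_of_indepFun (Finset.range n) _ hind
      (fun k => by fun_prop)
    rw [ENNReal.ofReal_prod_of_nonneg fun k _ => Real.rpow_nonneg (by linarith [ha k]) _]
    rw [Finset.prod_congr rfl fun k _ => (lintegral_exp_neg_gammaMeasure hb (ha k)).symm]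
    rw [Finset.prod_congr rfl fun k _ =>
      ((measurePreserving_eval_infinitePi (fun _ : ℕ => gammaMeasure b 1) k).lintegral_comp
          (f := fun x => ENNReal.ofReal (Real.exp (-(a k * x)))) (by fun_prop)).symm]
    refine Eq.trans (lintegral_congr fun g => ?_) this
    rw [← ENNReal.ofReal_prod_of_nonneg fun k _ => (Real.exp_pos _).le, ← Real.exp_sum,
      Finset.sum_neg_distrib]
  simp_rw [← hfin]
  -- Nonnegative terms keep every exponential below `1`, which dominates.
  refine tendsto_lintegral_of_dominated_convergence (fun _ => 1) (fun n => by fun_prop) ?_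
    (by simp) ?_
  · intro n
    filter_upwards [hsum] with g hg
    rw [ENNReal.ofReal_le_one, Real.exp_le_one_iff, neg_nonpos]
    exact Finset.sum_nonneg fun k _ => mul_nonneg (ha k) (hg.1 k)
  · filter_upwards [hsum] with g hg
    have h1 := hg.2.hasSum.tendsto_sum_nat
    exact (ENNReal.continuous_ofReal.tendsto _).comp ((Real.continuous_exp.tendsto _).comp h1.neg)

/-! ### The Pólya–Gamma law and its Laplace transform -/

/-- The coefficients of the series defining `PG(b, c)`. -/
noncomputable def pgCoeff (c : ℝ) (k : ℕ) : ℝ :=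
  1 / (2 * Real.pi ^ 2) / (((k : ℝ) + 1 - 1 / 2) ^ 2 + c ^ 2 / (4 * Real.pi ^ 2))

theorem pgCoeff_base_pos (k : ℕ) : 0 < ((k : ℝ) + 1 - 1 / 2) ^ 2 := by
  have : (0 : ℝ) ≤ k := k.cast_nonneg
  have : (0 : ℝ) < (k : ℝ) + 1 - 1 / 2 := by linarith
  positivity

theorem pgCoeff_denom_pos (c : ℝ) (k : ℕ) :
    0 < ((k : ℝ) + 1 - 1 / 2) ^ 2 + c ^ 2 / (4 * Real.pi ^ 2) :=
  add_pos_of_pos_of_nonneg (pgCoeff_base_pos k) (by positivity)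

theorem pgCoeff_nonneg (c : ℝ) (k : ℕ) : 0 ≤ pgCoeff c k :=
  div_nonneg (by positivity) (pgCoeff_denom_pos c k).le

theorem summable_pgCoeff (c : ℝ) : Summable (pgCoeff c) := by
  have h1 : Summable fun k : ℕ => 1 / ((k : ℝ) + 1 / 2) ^ (2 : ℝ) := by
    have := (Real.summable_one_div_nat_add_rpow (1 / 2) 2).2 (by norm_num)
    refine this.congr fun k => ?_
    rw [abs_of_nonneg (by positivity)]
  refine Summable.of_nonneg_of_le (pgCoeff_nonneg c) (fun k => ?_)
    (h1.mul_left (1 / (2 * Real.pi ^ 2)))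
  rw [pgCoeff, div_eq_mul_one_div]
  refine mul_le_mul_of_nonneg_left ?_ (by positivity)
  have e : ((k : ℝ) + 1 / 2) ^ (2 : ℝ) = ((k : ℝ) + 1 - 1 / 2) ^ 2 := by
    rw [Real.rpow_two]; ring
  rw [e]
  exact one_div_le_one_div_of_le (pgCoeff_base_pos k) (le_add_of_nonneg_right (by positivity))

theorem polyaGamma_eq_map (b c : ℝ) :
    polyaGamma b c = (Measure.infinitePi fun _ : ℕ => gammaMeasure b 1).map fun g : ℕ → ℝ =>
      ∑' k, pgCoeff c k * g k := by
  unfold polyaGamma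
  congr 1
  funext g
  rw [← tsum_mul_left]
  refine tsum_congr fun k => ?_
  rw [pgCoeff]; ring

theorem measurable_tsum_pgCoeff (c : ℝ) :
    Measurable fun g : ℕ → ℝ => ∑' k, pgCoeff c k * g k :=
  Measurable.tsum fun k => by fun_prop

theorem isProbabilityMeasure_polyaGamma {b : ℝ} (hb : 0 < b) (c : ℝ) :
    IsProbabilityMeasure (polyaGamma b c) := by
  have : IsProbabilityMeasure (gammaMeasure b 1) := isProbabilityMeasure_gammaMeasure hb one_pos
  rw [polyaGamma_eq_map]
  exact Measure.isProbabilityMeasure_map (measurable_tsum_pgCoeff c).aemeasurable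

theorem ae_nonneg_polyaGamma {b : ℝ} (hb : 0 < b) (c : ℝ) : ∀ᵐ x ∂polyaGamma b c, 0 ≤ x := by
  rw [polyaGamma_eq_map, ae_map_iff (measurable_tsum_pgCoeff c).aemeasurable measurableSet_Ici]
  filter_upwards [ae_summable_infinitePi_gammaMeasure hb (pgCoeff_nonneg c) (summable_pgCoeff c)]
    with g hg
  exact tsum_nonneg fun k => mul_nonneg (pgCoeff_nonneg c k) (hg.1 k)

open Filter Topology in
/-- The Laplace transform of the Pólya–Gamma distribution. -/
theorem lintegral_exp_neg_polyaGamma {b : ℝ} (hb : 0 < b) (c : ℝ) {l : ℝ} (hl : 0 ≤ l) :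
    ∫⁻ x, ENNReal.ofReal (Real.exp (-(l * x))) ∂polyaGamma b c =
      ENNReal.ofReal ((Real.cosh (c / 2) / Real.cosh (√(c ^ 2 + 2 * l) / 2)) ^ b) := by
  rw [polyaGamma_eq_map, lintegral_map (by fun_prop) (measurable_tsum_pgCoeff c)]
  simp_rw [← tsum_mul_left, ← mul_assoc]
  refine tendsto_nhds_unique (tendsto_prod_lintegral_exp_neg_tsum hb
    (fun k => mul_nonneg hl (pgCoeff_nonneg c k)) ((summable_pgCoeff c).mul_left l)) ?_
  refine (ENNReal.continuous_ofReal.tendsto _).comp ?_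
  -- With `D = (k + 1/2)²` one has `1 + l * pgCoeff c k = (D + (c² + 2l)/(4π²)) / (D + c²/(4π²))`,
  -- so the product of Laplace transforms is a quotient of two `cosh` products, raised to the power
  -- `b`.
  have h1 := (tendsto_cosh_prod c).div (tendsto_cosh_prod √(c ^ 2 + 2 * l)) (Real.cosh_pos _).ne'
  have h2 := h1.rpow_const (p := b) (Or.inr hb.le)
  refine h2.congr fun n => ?_
  simp only [Pi.div_apply]
  rw [← Finset.prod_div_distrib, ← Real.finsetProd_rpow]
  · refine Finset.prod_congr rfl fun k _ => ?_
    have hd := pgCoeff_base_pos k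
    have hk := pgCoeff_denom_pos c k
    rw [Real.sq_sqrt (by positivity)]
    have hp : 0 < 1 + l * pgCoeff c k := by
      have := mul_nonneg hl (pgCoeff_nonneg c k); linarith
    rw [Real.rpow_neg hp.le, ← Real.inv_rpow hp.le]
    congr 1
    rw [eq_comm, inv_eq_iff_eq_inv, inv_div, pgCoeff]
    generalize ((k : ℝ) + 1 - 1 / 2) ^ 2 = D at *
    have h3 : 0 < 1 + c ^ 2 / (4 * Real.pi ^ 2) / D := by positivity
    rw [eq_div_iff h3.ne']
    have hpi := Real.pi_pos
    field_simp
    have h4 : D * (4 * Real.pi ^ 2) + c ^ 2 ≠ 0 := by positivity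
    field_simp
    ring
  · intro k _
    have hd := pgCoeff_base_pos k
    positivity

/-! ### Uniqueness of Laplace transforms -/

open Polynomial in
/-- A finite measure on the nonnegative reals is determined by its Laplace transform at the
integers. -/
theorem ext_of_lintegral_exp_neg_nnreal {μ ν : Measure ℝ≥0} [IsFiniteMeasure μ] [IsFiniteMeasure ν]
    (hμν : ∀ n : ℕ, ∫⁻ x, ENNReal.ofReal (Real.exp (-(n * (x : ℝ)))) ∂μ =
      ∫⁻ x, ENNReal.ofReal (Real.exp (-(n * (x : ℝ)))) ∂ν) : μ = ν := by
  -- Polynomials in `e^{-x}` form an algebra of bounded continuous functions that separates points,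
  -- and their integrals are combinations of the transform at the integers.
  let f : BoundedContinuousFunction ℝ≥0 ℝ :=
    BoundedContinuousFunction.ofNormedAddCommGroup (fun x : ℝ≥0 => Real.exp (-(x : ℝ)))
      (by fun_prop) 1 (fun x => by
        rw [Real.norm_of_nonneg (Real.exp_pos _).le, Real.exp_le_one_iff]
        simp)
  have hf : ∀ x, f x = Real.exp (-(x : ℝ)) := fun x => rfl
  let A : StarSubalgebra ℝ (BoundedContinuousFunction ℝ≥0 ℝ) :=
    { Algebra.adjoin ℝ {f} with
      star_mem' := fun {g} hg => by
        have : star g = g := by ext x; simp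
        rw [this]; exact hg }
  have hfA : f ∈ A := Algebra.self_mem_adjoin_singleton ℝ f
  refine ext_of_forall_mem_subalgebra_integral_eq_of_polish (𝕜 := ℝ) (A := A) ?_ ?_
  · intro x y hxy
    refine ⟨f, ⟨BoundedContinuousFunction.toContinuousMapStarₐ ℝ f, ⟨f, hfA, rfl⟩, rfl⟩, ?_⟩
    rw [hf, hf]
    intro h
    exact hxy (by simpa using h)
  · intro g hg
    have hg' : g ∈ Algebra.adjoin ℝ {f} := hg
    rw [Algebra.adjoin_singleton_eq_range_aeval] at hg'
    obtain ⟨p, rfl⟩ := hg'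
    have hpow : ∀ (n : ℕ) (x : ℝ≥0), (f ^ n : BoundedContinuousFunction ℝ≥0 ℝ) x =
        Real.exp (-(n * (x : ℝ))) := by
      intro n x
      rw [BoundedContinuousFunction.pow_apply, hf, ← Real.exp_nat_mul, mul_neg]
    have hint : ∀ (ξ : Measure ℝ≥0) [IsFiniteMeasure ξ],
        ∫ x, (aeval f p : BoundedContinuousFunction ℝ≥0 ℝ) x ∂ξ =
        ∑ n ∈ Finset.range (p.natDegree + 1),
          p.coeff n * (∫⁻ x, ENNReal.ofReal (Real.exp (-(n * (x : ℝ)))) ∂ξ).toReal := by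
      intro ξ _
      have e : ∀ x, (aeval f p : BoundedContinuousFunction ℝ≥0 ℝ) x =
          ∑ n ∈ Finset.range (p.natDegree + 1), p.coeff n * (f ^ n : BoundedContinuousFunction ℝ≥0 ℝ) x := by
        intro x
        rw [aeval_eq_sum_range]
        simp
      simp_rw [e]
      rw [integral_finsetSum _ fun n _ =>
        ((f ^ n : BoundedContinuousFunction ℝ≥0 ℝ).integrable ξ).const_mul _]
      refine Finset.sum_congr rfl fun n _ => ?_
      rw [integral_const_mul]
      congr 1
      simp_rw [hpow]
      rw [integral_eq_lintegral_of_nonneg_ae (ae_of_all _ fun x => (Real.exp_pos _).le)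
        (by fun_prop)]
    rw [show (Polynomial.aeval f : ℝ[X] →ₐ[ℝ] _).toRingHom p = aeval f p from rfl, hint μ, hint ν]
    simp_rw [hμν]

/-- A finite measure carried by the nonnegative reals is determined by its Laplace transform. -/
theorem ext_of_lintegral_exp_neg {μ ν : Measure ℝ} [IsFiniteMeasure μ] [IsFiniteMeasure ν]
    (hμ : ∀ᵐ x ∂μ, 0 ≤ x) (hν : ∀ᵐ x ∂ν, 0 ≤ x)
    (hμν : ∀ l : ℝ, 0 ≤ l → ∫⁻ x, ENNReal.ofReal (Real.exp (-(l * x))) ∂μ =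
      ∫⁻ x, ENNReal.ofReal (Real.exp (-(l * x))) ∂ν) : μ = ν := by
  -- On all of `ℝ` the function `e^{-x}` is unbounded; a measure carried by the nonnegative reals is
  -- recovered from its image in `ℝ≥0`.
  have hback : ∀ {ξ : Measure ℝ}, (∀ᵐ x ∂ξ, 0 ≤ x) →
      (ξ.map Real.toNNReal).map ((↑) : ℝ≥0 → ℝ) = ξ := by
    intro ξ hξ
    rw [Measure.map_map (by fun_prop) (by fun_prop)]
    refine Eq.trans (Measure.map_congr ?_) Measure.map_id
    filter_upwards [hξ] with x hx
    simp [hx]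
  rw [← hback hμ, ← hback hν]
  congr 1
  refine ext_of_lintegral_exp_neg_nnreal fun n => ?_
  rw [lintegral_map (by fun_prop) (by fun_prop), lintegral_map (by fun_prop) (by fun_prop)]
  have hred : ∀ {ξ : Measure ℝ}, (∀ᵐ x ∂ξ, 0 ≤ x) →
      ∫⁻ x, ENNReal.ofReal (Real.exp (-(n * (x.toNNReal : ℝ)))) ∂ξ =
      ∫⁻ x, ENNReal.ofReal (Real.exp (-(n * x))) ∂ξ := by
    intro ξ hξ
    refine lintegral_congr_ae ?_
    filter_upwards [hξ] with x hx
    simp [hx]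
  rw [hred hμ, hred hν]
  exact hμν n n.cast_nonneg

/-! ### Exponential tilting -/

/-- The density of `PG(b, c)` with respect to `PG(b, 0)`. -/
noncomputable def pgTilt (b c x : ℝ) : ℝ≥0∞ :=
  ENNReal.ofReal (Real.cosh (c / 2) ^ b * Real.exp (-x * c ^ 2 / 2))

/-- `PG(b, c)` is an exponential tilting of `PG(b, 0)`. -/
theorem polyaGamma_eq_withDensity {b : ℝ} (hb : 0 < b) (c : ℝ) :
    polyaGamma b c = (polyaGamma b 0).withDensity (pgTilt b c) := by
  have := isProbabilityMeasure_polyaGamma hb c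
  have := isProbabilityMeasure_polyaGamma hb 0
  have hm : Measurable (pgTilt b c) := by unfold pgTilt; fun_prop
  have hcosh : 0 < Real.cosh (c / 2) ^ b := Real.rpow_pos_of_pos (Real.cosh_pos _) _
  have hL : ∀ l : ℝ, 0 ≤ l →
      ∫⁻ x, ENNReal.ofReal (Real.exp (-(l * x))) ∂(polyaGamma b 0).withDensity (pgTilt b c) =
      ∫⁻ x, ENNReal.ofReal (Real.exp (-(l * x))) ∂polyaGamma b c := by
    intro l hl
    rw [lintegral_withDensity_eq_lintegral_mul _ hm (by fun_prop)]
    -- The tilt shifts the Laplace variable from `l` to `l + c²/2`.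
    have e : ∀ x, (pgTilt b c * fun x => ENNReal.ofReal (Real.exp (-(l * x)))) x =
        ENNReal.ofReal (Real.cosh (c / 2) ^ b) *
          ENNReal.ofReal (Real.exp (-((l + c ^ 2 / 2) * x))) := by
      intro x
      rw [Pi.mul_apply, pgTilt, ← ENNReal.ofReal_mul (by positivity),
        ← ENNReal.ofReal_mul (by positivity), mul_assoc, ← Real.exp_add]
      congr 3; ring
    simp_rw [e]
    rw [lintegral_const_mul _ (by fun_prop), lintegral_exp_neg_polyaGamma hb 0 (by positivity),
      lintegral_exp_neg_polyaGamma hb c hl, ← ENNReal.ofReal_mul hcosh.le,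
      ← Real.mul_rpow (Real.cosh_pos _).le (by positivity)]
    congr 2
    rw [zero_div, Real.cosh_zero, show (0 : ℝ) ^ 2 + 2 * (l + c ^ 2 / 2) = c ^ 2 + 2 * l by ring]
    ring
  have hfin : IsFiniteMeasure ((polyaGamma b 0).withDensity (pgTilt b c)) := by
    constructor
    have := hL 0 le_rfl
    simp only [zero_mul, neg_zero, Real.exp_zero, ENNReal.ofReal_one, lintegral_one] at this
    rw [this]; simp
  refine ext_of_lintegral_exp_neg (ae_nonneg_polyaGamma hb c) ?_ fun l hl => (hL l hl).symm
  exact (withDensity_absolutelyContinuous _ _).ae_le (ae_nonneg_polyaGamma hb 0)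

/-! ### Binary logistic form of the allocation likelihood -/

section Logistic

variable {n d : ℕ}

theorem one_add_exp_eq_cosh (η : ℝ) : 1 + Real.exp η = 2 * Real.exp (η / 2) * Real.cosh (η / 2) := by
  have h1 : Real.exp η = Real.exp (η / 2) * Real.exp (η / 2) := by rw [← Real.exp_add]; ring_nf
  have h2 : Real.exp (η / 2) * Real.exp (-(η / 2)) = 1 := by rw [← Real.exp_add]; simp
  rw [Real.cosh_eq, h1]
  linear_combination -h2

/-- The bound `a ≤ b` makes the truncated subtraction in the exponent `b - a` a true one, so the
denominators combine into a single power. -/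
theorem logisticLik_eq {a b : ℕ} (hab : a ≤ b) (η : ℝ) :
    logisticLik a b η = Real.exp (a * η) / (1 + Real.exp η) ^ b := by
  rw [logisticLik, div_pow, div_pow, one_pow, div_mul_div_comm, mul_one, ← pow_add,
    Nat.add_sub_cancel' hab, Real.exp_nat_mul]

theorem logisticLik_pos (a b : ℕ) (η : ℝ) : 0 < logisticLik a b η := by
  unfold logisticLik; positivity

theorem pgFactor_pos (a b : ℕ) (η ω : ℝ) : 0 < pgFactor a b η ω := by
  unfold pgFactor; positivity

/-- The ratio of the augmented and the original likelihood factor is the density of `PG(b, η)` with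
respect to `PG(b, 0)`. -/
theorem pgFactor_div_logisticLik {a b : ℕ} (hab : a ≤ b) (η ω : ℝ) :
    pgFactor a b η ω / logisticLik a b η =
      Real.cosh (η / 2) ^ (b : ℝ) * Real.exp (-ω * η ^ 2 / 2) := by
  have hc := Real.cosh_pos (η / 2)
  rw [logisticLik_eq hab, one_add_exp_eq_cosh, pgFactor, Real.rpow_natCast, mul_pow, mul_pow,
    ← Real.exp_nat_mul]
  have : Real.exp ((a - b / 2) * η) = Real.exp (a * η) / Real.exp (b * (η / 2)) := by
    rw [← Real.exp_sub]; congr 1; ring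
  rw [this]
  field_simp

theorem allocCount_le (h : Fin d) (s : Fin n → Fin (d + 1)) : allocCount h s ≤ n := by
  simpa [allocCount] using Finset.card_filter_le (Finset.univ : Finset (Fin n)) fun j => s j = h.castSucc

theorem extWeight_castSucc (v : Fin d → ℝ) (k : Fin d) : extWeight v k.castSucc = v k := by
  simp [extWeight]

theorem extWeight_last (v : Fin d → ℝ) : extWeight v (Fin.last d) = 0 := by
  simp [extWeight]

theorem extWeight_congr {h : Fin d} {v v' : Fin d → ℝ} (hv : ∀ k, k ≠ h → v k = v' k)
    {k : Fin (d + 1)} (hk : k ≠ h.castSucc) : extWeight v k = extWeight v' k := by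
  induction k using Fin.lastCases with
  | last => simp [extWeight_last]
  | cast k =>
    rw [extWeight_castSucc, extWeight_castSucc]
    exact hv k fun e => hk (by rw [e])

theorem offset_congr {h : Fin d} {v v' : Fin d → ℝ} (hv : ∀ k, k ≠ h → v k = v' k) :
    offset h v = offset h v' := by
  unfold offset
  congr 1
  exact Finset.sum_congr rfl fun k hk => by rw [extWeight_congr hv (Finset.ne_of_mem_erase hk)]

theorem exp_offset (h : Fin d) (v : Fin d → ℝ) :
    Real.exp (offset h v) = ∑ k ∈ Finset.univ.erase h.castSucc, Real.exp (extWeight v k) := by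
  rw [offset, Real.exp_log]
  -- The reference component is never `h`, so the sum is nonempty even when `d = 1`.
  exact Finset.sum_pos (fun k _ => Real.exp_pos _)
    ⟨Fin.last d, Finset.mem_erase.2 ⟨(Fin.castSucc_lt_last h).ne', Finset.mem_univ _⟩⟩

/-- Splitting off component `h` isolates `η_h`; this reduces the multinomial logit to a binary one
in the coordinate `h`. -/
theorem one_add_sum_exp (h : Fin d) (v : Fin d → ℝ) :
    1 + ∑ l, Real.exp (v l) = Real.exp (offset h v) * (1 + Real.exp (v h - offset h v)) := by
  rw [mul_add, mul_one, ← Real.exp_add, add_sub_cancel, exp_offset, ← extWeight_castSucc v h,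
    Finset.sum_erase_add _ _ (Finset.mem_univ _), Fin.sum_univ_castSucc, extWeight_last,
    Real.exp_zero, add_comm]
  simp_rw [extWeight_castSucc]

/-- As a function of `v h`, the likelihood of the allocations of an area is proportional to
`logisticLik`. -/
theorem prod_alrInv (h : Fin d) (v : Fin d → ℝ) (s : Fin n → Fin (d + 1)) :
    ∏ j, alrInv v (s j) = logisticLik (allocCount h s) n (v h - offset h v) *
      ∏ j, if s j = h.castSucc then 1 else Real.exp (extWeight v (s j) - offset h v) := by
  -- Each probability is that of the binary choice "`h` or not" times the conditional probability of
  -- the component within its class; the latter is free of `v h`.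
  have e1 : ∀ j, alrInv v (s j) =
      (if s j = h.castSucc then
        Real.exp (v h - offset h v) / (1 + Real.exp (v h - offset h v)) else
        1 / (1 + Real.exp (v h - offset h v))) *
      (if s j = h.castSucc then 1 else Real.exp (extWeight v (s j) - offset h v)) := by
    intro j
    rw [alrInv, one_add_sum_exp h v]
    split_ifs with hj
    · rw [hj, extWeight_castSucc, Real.exp_sub, mul_one]
      have := Real.exp_pos (offset h v)
      field_simp
    · have := Real.exp_pos (offset h v)
      have e : Real.exp (extWeight v (s j)) =
          Real.exp (offset h v) * Real.exp (extWeight v (s j) - offset h v) := by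
        rw [← Real.exp_add, add_sub_cancel]
      rw [e]
      field_simp
  rw [Finset.prod_congr rfl fun j _ => e1 j, Finset.prod_mul_distrib, Finset.prod_ite,
    Finset.prod_const, Finset.prod_const, logisticLik, allocCount]
  congr 3
  have := Finset.card_filter_add_card_filter_not (s := (Finset.univ : Finset (Fin n)))
    (fun j => s j = h.castSucc)
  rw [Finset.card_univ, Fintype.card_fin] at this
  omega

end Logistic

/-! ### Schur complement -/

section Schur

variable {d : ℕ}

/-- The row of `S⁻¹` through the Schur complement: the diagonal entry. -/
theorem inv_apply_mul_schur {S : Matrix (Fin d) (Fin d) ℝ} (hS : S.PosDef) (h : Fin d) :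
    S⁻¹ h h * (S h h - (fun k : {k // k ≠ h} => S h k) ⬝ᵥ
      ((S.submatrix (Subtype.val : {k // k ≠ h} → Fin d) Subtype.val)⁻¹ *ᵥ
        fun k : {k // k ≠ h} => S k h)) = 1 ∧
    ∀ u : Fin d → ℝ, ∑ k, S⁻¹ h k * u k = S⁻¹ h h * (u h - (fun k : {k // k ≠ h} => S h k) ⬝ᵥ
      ((S.submatrix (Subtype.val : {k // k ≠ h} → Fin d) Subtype.val)⁻¹ *ᵥ
        fun k : {k // k ≠ h} => u k)) := by
  set D := S.submatrix (Subtype.val : {k // k ≠ h} → Fin d) Subtype.val with hD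
  have hDpos : D.PosDef := hS.submatrix Subtype.val_injective
  have hDu : IsUnit D.det := (Matrix.isUnit_iff_isUnit_det D).1 hDpos.isUnit
  have hSu : IsUnit S.det := (Matrix.isUnit_iff_isUnit_det S).1 hS.isUnit
  have hTS : S⁻¹ * S = 1 := Matrix.nonsing_inv_mul S hSu
  have split : ∀ f : Fin d → ℝ, ∑ k, f k = f h + ∑ k : {k // k ≠ h}, f k := fun f =>
    Fintype.sum_eq_add_sum_subtype_ne f h
  -- Row `h` of `S⁻¹ S = 1` away from the diagonal; solving for the off-diagonal part of the row of
  -- `S⁻¹` only requires inverting `D`.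
  have hoff : (fun k : {k // k ≠ h} => S⁻¹ h k) ᵥ* D = -(S⁻¹ h h) • fun k : {k // k ≠ h} => S h k := by
    funext k
    have := congrFun (congrFun hTS h) k
    rw [Matrix.mul_apply, split, Matrix.one_apply_ne k.2.symm] at this
    simp only [Matrix.vecMul, dotProduct, hD, Matrix.submatrix_apply, Pi.smul_apply, smul_eq_mul]
    linarith
  have hrow : (fun k : {k // k ≠ h} => S⁻¹ h k) =
      -(S⁻¹ h h) • ((fun k : {k // k ≠ h} => S h k) ᵥ* D⁻¹) := by
    rw [← Matrix.smul_vecMul, ← hoff, Matrix.vecMul_vecMul, Matrix.mul_nonsing_inv D hDu,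
      Matrix.vecMul_one]
  have hu : ∀ u : Fin d → ℝ, ∑ k, S⁻¹ h k * u k = S⁻¹ h h * (u h -
      (fun k : {k // k ≠ h} => S h k) ⬝ᵥ (D⁻¹ *ᵥ fun k : {k // k ≠ h} => u k)) := by
    intro u
    rw [split, Matrix.dotProduct_mulVec]
    have : ∑ k : {k // k ≠ h}, S⁻¹ h k * u k =
        (fun k : {k // k ≠ h} => S⁻¹ h k) ⬝ᵥ fun k : {k // k ≠ h} => u k := rfl
    rw [this, hrow, smul_dotProduct, smul_eq_mul]
    ring
  refine ⟨?_, hu⟩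
  -- Taking for `u` the column `h` of `S` turns the left side into the diagonal entry of `S⁻¹ S`.
  rw [← hu fun k => S k h]
  have := congrFun (congrFun hTS h) h
  rwa [Matrix.mul_apply, Matrix.one_apply_eq] at this

end Schur

/-! ### Conditioning the MCAR prior on all entries but one -/

section Conditional

variable {I d : ℕ} (G : SimpleGraph (Fin I)) [DecidableRel G.Adj]

theorem carScale_pos {ρ : ℝ} (hρ : ρ ∈ Set.Ioo (0 : ℝ) 1) (i : Fin I) : 0 < carScale G ρ i := by
  have : 0 ≤ ∑ j, G.adjMatrix ℝ i j :=
    Finset.sum_nonneg fun j _ => by rw [SimpleGraph.adjMatrix_apply]; split_ifs <;> norm_num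
  have := mul_nonneg hρ.1.le this
  have := hρ.2
  unfold carScale; linarith

/-- The conditional precision of a Gaussian coordinate is the diagonal entry of the joint precision;
the Schur complement makes this explicit. -/
theorem inv_sigmaStar {ρ : ℝ} {S : Matrix (Fin d) (Fin d) ℝ} (hS : S.PosDef)
    (i : Fin I) (h : Fin d) : (sigmaStar G ρ S i h)⁻¹ = carScale G ρ i * S⁻¹ h h := by
  rw [sigmaStar, mul_inv, inv_inv, eq_inv_of_mul_eq_one_left (inv_apply_mul_schur hS h).1]

theorem sigmaStar_pos {ρ : ℝ} (hρ : ρ ∈ Set.Ioo (0 : ℝ) 1) {S : Matrix (Fin d) (Fin d) ℝ}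
    (hS : S.PosDef) (i : Fin I) (h : Fin d) : 0 < sigmaStar G ρ S i h := by
  rw [← inv_pos, inv_sigmaStar G hS]
  exact mul_pos (carScale_pos G hρ i) hS.inv.diag_pos

/-- The conditional mean `μ_i` in centred form. -/
theorem sum_carMatrix_mul {ρ : ℝ} (hρ : ρ ∈ Set.Ioo (0 : ℝ) 1)
    (m : G.ConnectedComponent → Fin d → ℝ) (w : Fin I → Fin d → ℝ) (i : Fin I) (k : Fin d) :
    ∑ j, (Matrix.diagonal (carScale G ρ) - ρ • G.adjMatrix ℝ) i j * (w j k - areaMean G m j k) =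
      carScale G ρ i * (w i k - condMean G ρ m w i k) := by
  have hf := (carScale_pos G hρ i).ne'
  -- Neighbours lie in one connected component and share their mean. Hence `ρ ∑ g_ij m̃_j` and `(1 -
  -- ρ) m̃_i` add up to `f_i m̃_i`.
  have e1 : ∀ j, G.adjMatrix ℝ i j * areaMean G m j k = G.adjMatrix ℝ i j * areaMean G m i k := by
    intro j
    rw [SimpleGraph.adjMatrix_apply]
    split_ifs with hij
    · rw [areaMean, areaMean, SimpleGraph.ConnectedComponent.eq.2 hij.reachable]
    · simp
  have e2 : ∀ j, (Matrix.diagonal (carScale G ρ) - ρ • G.adjMatrix ℝ) i j *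
      (w j k - areaMean G m j k) = (if i = j then carScale G ρ i else 0) *
        (w j k - areaMean G m j k) - (ρ * (G.adjMatrix ℝ i j * w j k) -
          ρ * G.adjMatrix ℝ i j * areaMean G m i k) := by
    intro j
    rw [Matrix.sub_apply, Matrix.diagonal_apply, Matrix.smul_apply, smul_eq_mul]
    linear_combination ρ * e1 j
  rw [Finset.sum_congr rfl fun j _ => e2 j, Finset.sum_sub_distrib, Finset.sum_sub_distrib,
    ← Finset.mul_sum, ← Finset.sum_mul, ← Finset.mul_sum]
  simp only [ite_mul, zero_mul, Finset.sum_ite_eq, Finset.mem_univ, if_true]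
  rw [condMean, mul_sub, mul_sub, mul_div_cancel₀ _ hf]
  have : carScale G ρ i * areaMean G m i k = ρ * (∑ j, G.adjMatrix ℝ i j) * areaMean G m i k +
      (1 - ρ) * areaMean G m i k := by rw [carScale]; ring
  linear_combination -this

/-- The gradient of the MCAR quadratic form in the direction of one transformed weight. -/
theorem mcarPrecision_mulVec {ρ : ℝ} (hρ : ρ ∈ Set.Ioo (0 : ℝ) 1) {S : Matrix (Fin d) (Fin d) ℝ}
    (hS : S.PosDef) (m : G.ConnectedComponent → Fin d → ℝ) (w : Fin I → Fin d → ℝ) (i : Fin I)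
    (h : Fin d) :
    (mcarPrecision G ρ S *ᵥ fun p => w p.1 p.2 - areaMean G m p.1 p.2) (i, h) =
      (w i h - muStar G ρ S m w i h) / sigmaStar G ρ S i h := by
  rw [div_eq_mul_inv, inv_sigmaStar G hS]
  simp only [Matrix.mulVec, dotProduct, mcarPrecision, Matrix.kroneckerMap_apply]
  rw [Fintype.sum_prod_type, Finset.sum_comm]
  have : ∀ k, ∑ j, (Matrix.diagonal (carScale G ρ) - ρ • G.adjMatrix ℝ) i j * S⁻¹ h k *
      (w j k - areaMean G m j k) =
      carScale G ρ i * (S⁻¹ h k * (w i k - condMean G ρ m w i k)) := by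
    intro k
    rw [mul_left_comm, ← sum_carMatrix_mul G hρ, Finset.mul_sum]
    exact Finset.sum_congr rfl fun j _ => by ring
  rw [Finset.sum_congr rfl fun k _ => this k, ← Finset.mul_sum,
    (inv_apply_mul_schur hS h).2 fun k => w i k - condMean G ρ m w i k, muStar]
  ring

theorem mcarPrecision_isSymm (ρ : ℝ) {S : Matrix (Fin d) (Fin d) ℝ} (hS : S.PosDef) :
    (mcarPrecision G ρ S)ᵀ = mcarPrecision G ρ S := by
  have hSt : Sᵀ = S := by simpa using hS.isHermitian.eq
  rw [mcarPrecision, ← Matrix.kroneckerMap_transpose, Matrix.transpose_nonsing_inv, hSt,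
    Matrix.transpose_sub, Matrix.diagonal_transpose, Matrix.transpose_smul,
    SimpleGraph.transpose_adjMatrix]

/-- Dependence on the single entry `(i, h)` is expressed by comparing two arrays `w`, `w'` with
equal `otherWeights`. -/
theorem apply_eq_of_otherWeights_eq {i : Fin I} {h : Fin d} {w w' : Fin I → Fin d → ℝ}
    (hw : otherWeights i h w = otherWeights i h w') {j : Fin I} {k : Fin d}
    (hjk : (j, k) ≠ (i, h)) : w j k = w' j k :=
  congrFun hw ⟨(j, k), hjk⟩

theorem row_eq_of_otherWeights_eq {i : Fin I} {h : Fin d} {w w' : Fin I → Fin d → ℝ}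
    (hw : otherWeights i h w = otherWeights i h w') {j : Fin I} (hj : j ≠ i) : w j = w' j :=
  funext fun _ => apply_eq_of_otherWeights_eq hw fun e => hj (Prod.ext_iff.1 e).1

theorem entry_eq_of_otherWeights_eq {i : Fin I} {h : Fin d} {w w' : Fin I → Fin d → ℝ}
    (hw : otherWeights i h w = otherWeights i h w') (k : Fin d) (hk : k ≠ h) : w i k = w' i k :=
  apply_eq_of_otherWeights_eq hw fun e => hk (Prod.ext_iff.1 e).2

theorem condMean_congr (ρ : ℝ) (m : G.ConnectedComponent → Fin d → ℝ) {i : Fin I} {h : Fin d}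
    {w w' : Fin I → Fin d → ℝ} (hw : otherWeights i h w = otherWeights i h w') (k : Fin d) :
    condMean G ρ m w i k = condMean G ρ m w' i k := by
  unfold condMean
  congr 3
  refine Finset.sum_congr rfl fun j _ => ?_
  -- Row `i` is the only one that may differ, and an area is not its own neighbour.
  rcases eq_or_ne j i with rfl | hj
  · simp
  · rw [row_eq_of_otherWeights_eq hw hj]

theorem muStar_congr (ρ : ℝ) (S : Matrix (Fin d) (Fin d) ℝ) (m : G.ConnectedComponent → Fin d → ℝ)
    {i : Fin I} {h : Fin d} {w w' : Fin I → Fin d → ℝ}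
    (hw : otherWeights i h w = otherWeights i h w') :
    muStar G ρ S m w i h = muStar G ρ S m w' i h := by
  unfold muStar
  simp_rw [condMean_congr G ρ m hw]
  congr 3
  funext k
  rw [entry_eq_of_otherWeights_eq hw k k.2]

theorem muHat_congr (ρ : ℝ) (S : Matrix (Fin d) (Fin d) ℝ) (m : G.ConnectedComponent → Fin d → ℝ)
    {i : Fin I} {h : Fin d} {w w' : Fin I → Fin d → ℝ}
    (hw : otherWeights i h w = otherWeights i h w') {n : ℕ} (s : Fin n → Fin (d + 1)) (ω : ℝ) :
    muHat G ρ S m w i h s ω = muHat G ρ S m w' i h s ω := by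
  unfold muHat
  rw [muStar_congr G ρ S m hw, offset_congr (entry_eq_of_otherWeights_eq hw)]

theorem gaussHat_congr (ρ : ℝ) (S : Matrix (Fin d) (Fin d) ℝ)
    (m : G.ConnectedComponent → Fin d → ℝ)
    {i : Fin I} {h : Fin d} {w w' : Fin I → Fin d → ℝ}
    (hw : otherWeights i h w = otherWeights i h w') {n : ℕ} (s : Fin n → Fin (d + 1)) (ω : ℝ) :
    gaussHat G ρ S m w i h s ω = gaussHat G ρ S m w' i h s ω := by
  unfold gaussHat
  rw [muHat_congr G ρ S m hw]

/-- The MCAR density as a function of one transformed weight. -/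
theorem mcarPDF_mul_exp {ρ : ℝ} (hρ : ρ ∈ Set.Ioo (0 : ℝ) 1) {S : Matrix (Fin d) (Fin d) ℝ}
    (hS : S.PosDef) (m : G.ConnectedComponent → Fin d → ℝ) {i : Fin I} {h : Fin d}
    {w w' : Fin I → Fin d → ℝ} (hw : otherWeights i h w = otherWeights i h w') :
    mcarPDF G ρ S m w = mcarPDF G ρ S m w' * Real.exp (-((w i h - w' i h) *
      (w i h + w' i h - 2 * muStar G ρ S m w i h) / sigmaStar G ρ S i h) / 2) := by
  set x : Fin I × Fin d → ℝ := fun p => w p.1 p.2 - areaMean G m p.1 p.2 with hx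
  set x' : Fin I × Fin d → ℝ := fun p => w' p.1 p.2 - areaMean G m p.1 p.2 with hx'
  set Q := mcarPrecision G ρ S with hQ
  have hdiff : x - x' = Pi.single (i, h) (w i h - w' i h) := by
    funext p
    by_cases hp : p = (i, h)
    · subst hp; simp [hx, hx']
    · rw [Pi.single_eq_of_ne hp]
      simp [hx, hx', apply_eq_of_otherWeights_eq (j := p.1) (k := p.2) hw hp]
  -- Symmetry of `Q` factors the difference of the quadratic forms. As `x - x'` is supported at `(i,
  -- h)`, only that entry of `Q x` and `Q x'` is needed.
  have hquad : x ⬝ᵥ (Q *ᵥ x) - x' ⬝ᵥ (Q *ᵥ x') = (x - x') ⬝ᵥ (Q *ᵥ x + Q *ᵥ x') := by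
    have : x' ⬝ᵥ (Q *ᵥ x) = x ⬝ᵥ (Q *ᵥ x') := by
      rw [Matrix.dotProduct_mulVec, ← Matrix.mulVec_transpose, hQ, mcarPrecision_isSymm G ρ hS,
        dotProduct_comm]
    rw [sub_dotProduct, dotProduct_add, dotProduct_add, this]
    ring
  rw [hdiff, single_dotProduct, Pi.add_apply, hQ, hx, hx', mcarPrecision_mulVec G hρ hS,
    mcarPrecision_mulVec G hρ hS, ← muStar_congr G ρ S m hw, ← hx, ← hx', ← hQ] at hquad
  have e : x ⬝ᵥ (Q *ᵥ x) = x' ⬝ᵥ (Q *ᵥ x') + (w i h - w' i h) *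
      (w i h + w' i h - 2 * muStar G ρ S m w i h) / sigmaStar G ρ S i h := by
    rw [sub_eq_iff_eq_add] at hquad
    rw [hquad]; ring
  change Real.sqrt (Q.det / (2 * Real.pi) ^ (I * d)) * Real.exp (-(x ⬝ᵥ (Q *ᵥ x)) / 2) =
    Real.sqrt (Q.det / (2 * Real.pi) ^ (I * d)) * Real.exp (-(x' ⬝ᵥ (Q *ᵥ x')) / 2) * _
  rw [e, mul_assoc, ← Real.exp_add]
  congr 2; ring

/-- The likelihood of the allocations times the augmentation factor, as a function of one
transformed weight. -/
theorem prod_alrInv_mul_pgFactor {N : Fin I → ℕ} {i : Fin I} {h : Fin d}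
    {w w' : Fin I → Fin d → ℝ} (hw : otherWeights i h w = otherWeights i h w')
    (s : (i : Fin I) → Fin (N i) → Fin (d + 1)) (ω : ℝ) :
    (∏ i, ∏ j, alrInv (w i) (s i j)) *
      (pgFactor (allocCount h (s i)) (N i) (w i h - offset h (w i)) ω /
        logisticLik (allocCount h (s i)) (N i) (w i h - offset h (w i))) =
    (∏ i, ∏ j, alrInv (w' i) (s i j)) *
      (pgFactor (allocCount h (s i)) (N i) (w' i h - offset h (w' i)) ω /
        logisticLik (allocCount h (s i)) (N i) (w' i h - offset h (w' i))) *
      Real.exp ((allocCount h (s i) - N i / 2) * (w i h - w' i h) -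
        ω * (w i h - w' i h) * (w i h + w' i h - 2 * offset h (w i)) / 2) := by
  have hoff := offset_congr (entry_eq_of_otherWeights_eq hw)
  have hrest : ∏ x ∈ Finset.univ.erase i, ∏ j, alrInv (w x) (s x j) =
      ∏ x ∈ Finset.univ.erase i, ∏ j, alrInv (w' x) (s x j) :=
    Finset.prod_congr rfl fun x hx => by
      rw [row_eq_of_otherWeights_eq hw (Finset.ne_of_mem_erase hx)]
  have hext : (∏ j, if s i j = h.castSucc then 1 else
      Real.exp (extWeight (w i) (s i j) - offset h (w i))) =
      ∏ j, if s i j = h.castSucc then 1 else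
        Real.exp (extWeight (w' i) (s i j) - offset h (w i)) :=
    Finset.prod_congr rfl fun j _ => by
      split_ifs with hj
      · rfl
      · rw [extWeight_congr (entry_eq_of_otherWeights_eq hw) hj]
  rw [← Finset.mul_prod_erase Finset.univ _ (Finset.mem_univ i),
    ← Finset.mul_prod_erase Finset.univ (fun i => ∏ j, alrInv (w' i) (s i j)) (Finset.mem_univ i),
    prod_alrInv h (w i), prod_alrInv h (w' i), ← hoff, hrest, hext]
  have hl := (logisticLik_pos (allocCount h (s i)) (N i) (w i h - offset h (w i))).ne'
  have hl' := (logisticLik_pos (allocCount h (s i)) (N i) (w' i h - offset h (w i))).ne'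
  -- The logistic factors cancel against `logisticLik`. In what remains, `η - η' = w i h - w' i h`
  -- and `η² - η'² = (η - η')(w i h + w' i h - 2C)`.
  have hpg : pgFactor (allocCount h (s i)) (N i) (w i h - offset h (w i)) ω =
      pgFactor (allocCount h (s i)) (N i) (w' i h - offset h (w i)) ω *
      Real.exp ((allocCount h (s i) - N i / 2) * (w i h - w' i h) -
        ω * (w i h - w' i h) * (w i h + w' i h - 2 * offset h (w i)) / 2) := by
    rw [pgFactor, pgFactor, mul_assoc, mul_assoc, mul_assoc, ← Real.exp_add, ← Real.exp_add,
      ← Real.exp_add]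
    congr 2; ring
  rw [hpg]
  field_simp

theorem sigmaHat_pos {ρ : ℝ} (hρ : ρ ∈ Set.Ioo (0 : ℝ) 1) {S : Matrix (Fin d) (Fin d) ℝ}
    (hS : S.PosDef) (i : Fin I) (h : Fin d) {ω : ℝ} (hω : 0 ≤ ω) : 0 < sigmaHat G ρ S i h ω := by
  have := sigmaStar_pos G hρ hS i h
  unfold sigmaHat; positivity

/-- The density of the augmented model, up to the factors that do not involve the transformed
weights. -/
noncomputable def weightDensity {N : Fin I → ℕ} (ρ : ℝ) (S : Matrix (Fin d) (Fin d) ℝ)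
    (m : G.ConnectedComponent → Fin d → ℝ) (i : Fin I) (h : Fin d)
    (s : (i : Fin I) → Fin (N i) → Fin (d + 1)) (ω : ℝ) (w : Fin I → Fin d → ℝ) : ℝ :=
  mcarPDF G ρ S m w * ((∏ i, ∏ j, alrInv (w i) (s i j)) *
      (pgFactor (allocCount h (s i)) (N i) (w i h - offset h (w i)) ω /
        logisticLik (allocCount h (s i)) (N i) (w i h - offset h (w i))))

/-- As a function of `w̃_ih`, the density of the augmented model is proportional to that of
`N(μ̂_ih, Σ̂_ih)`. -/
theorem weightDensity_mul_gaussianPDFReal {N : Fin I → ℕ} {ρ : ℝ} (hρ : ρ ∈ Set.Ioo (0 : ℝ) 1)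
    {S : Matrix (Fin d) (Fin d) ℝ} (hS : S.PosDef) (m : G.ConnectedComponent → Fin d → ℝ)
    {i : Fin I} {h : Fin d} {w w' : Fin I → Fin d → ℝ}
    (hw : otherWeights i h w = otherWeights i h w')
    (s : (i : Fin I) → Fin (N i) → Fin (d + 1)) {ω : ℝ} (hω : 0 ≤ ω) :
    weightDensity G ρ S m i h s ω w * gaussianPDFReal (muHat G ρ S m w i h (s i) ω)
        (sigmaHat G ρ S i h ω).toNNReal (w' i h) =
    weightDensity G ρ S m i h s ω w' * gaussianPDFReal (muHat G ρ S m w i h (s i) ω)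
        (sigmaHat G ρ S i h ω).toNNReal (w i h) := by
  have hstar := sigmaStar_pos G hρ hS i h
  have hhat := sigmaHat_pos G hρ hS i h hω
  rw [weightDensity, weightDensity, prod_alrInv_mul_pgFactor hw, mcarPDF_mul_exp G hρ hS m hw,
    gaussianPDFReal, gaussianPDFReal, Real.coe_toNNReal _ hhat.le]
  set A := mcarPDF G ρ S m w'
  generalize (∏ i, ∏ j, alrInv (w' i) (s i j)) *
    (pgFactor (allocCount h (s i)) (N i) (w' i h - offset h (w' i)) ω /
        logisticLik (allocCount h (s i)) (N i) (w' i h - offset h (w' i))) = B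
  -- All constants agree on both sides, so only the exponents have to be compared.
  have key : ∀ {a b c e f : ℝ}, a + b + c = e → A * Real.exp a * (B * Real.exp b) *
      (f * Real.exp c) = A * B * (f * Real.exp e) := by
    intro a b c e f habc
    rw [← habc, Real.exp_add, Real.exp_add]; ring
  refine key ?_
  have hV : ∀ x : ℝ, x / (2 * sigmaHat G ρ S i h ω) = x * (1 / sigmaStar G ρ S i h + ω) / 2 := by
    intro x
    rw [sigmaHat, mul_comm, ← div_div, div_inv_eq_mul]
  -- Completing the square: mean times precision is the coefficient of the linear term.
  have hM : muHat G ρ S m w i h (s i) ω * (1 / sigmaStar G ρ S i h + ω) =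
      muStar G ρ S m w i h / sigmaStar G ρ S i h + allocCount h (s i) - (N i : ℝ) / 2 +
        ω * offset h (w i) := by
    have : 1 / sigmaStar G ρ S i h + ω ≠ 0 := by positivity
    rw [muHat, inv_mul_cancel_right₀ this]
  rw [hV, hV]
  generalize muHat G ρ S m w i h (s i) ω = M at hM ⊢
  generalize muStar G ρ S m w i h = mu at hM ⊢
  generalize sigmaStar G ρ S i h = V at hM ⊢
  generalize offset h (w i) = C at hM ⊢
  linear_combination -(w i h - w' i h) * hM

end Conditional

/-! ### Disintegration and Gibbs steps -/

section Kernels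

variable {α β γ Ω : Type*} [MeasurableSpace α] [MeasurableSpace β] [MeasurableSpace γ]
  [MeasurableSpace Ω]

theorem map_compProd_comap (ξ : Measure α) [SFinite ξ] (κ : Kernel β γ) [IsSFiniteKernel κ]
    {f : α → β} (hf : Measurable f) :
    (ξ ⊗ₘ κ.comap f hf).map (Prod.map f id) = (ξ.map f) ⊗ₘ κ := by
  refine Measure.ext_of_lintegral _ fun F hF => ?_
  rw [lintegral_map hF (by fun_prop), Measure.lintegral_compProd (by fun_prop),
    Measure.lintegral_compProd hF, lintegral_map (by fun_prop) hf]
  rfl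

/-- If the conditional law of `X` given `U` depends only on `f ∘ U`, it is also the conditional
law given `f ∘ U`. -/
theorem map_eq_compProd_of_comap {P : Measure Ω} [IsProbabilityMeasure P] {U : Ω → α} {X : Ω → γ}
    (hU : Measurable U) (hX : Measurable X) {ξ : Measure α} [SFinite ξ] {κ : Kernel β γ}
    [IsMarkovKernel κ] {f : α → β} (hf : Measurable f)
    (hlaw : P.map (fun a => (U a, X a)) = ξ ⊗ₘ κ.comap f hf) :
    P.map (fun a => (f (U a), X a)) = P.map (fun a => f (U a)) ⊗ₘ κ := by
  have h1 : P.map (fun a => (f (U a), X a)) = ξ.map f ⊗ₘ κ := by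
    rw [← map_compProd_comap ξ κ hf, ← hlaw, Measure.map_map (by fun_prop) (by fun_prop)]
    rfl
  -- The kernel is Markov, so first marginals identify `ξ.map f`; the measure `ξ` need not be known
  -- in advance.
  have h2 : P.map (fun a => f (U a)) = ξ.map f := by
    have := congrArg Measure.fst h1
    rwa [Measure.fst_compProd, Measure.fst_map_prodMk hX] at this
  rw [h1, h2]

theorem condDistrib_ae_eq_of_comap [StandardBorelSpace γ] [Nonempty γ] {P : Measure Ω}
    [IsProbabilityMeasure P] {U : Ω → α} {X : Ω → γ}
    (hU : Measurable U) (hX : Measurable X) {ξ : Measure α} [SFinite ξ] {κ : Kernel β γ}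
    [IsMarkovKernel κ] {f : α → β} (hf : Measurable f)
    (hlaw : P.map (fun a => (U a, X a)) = ξ ⊗ₘ κ.comap f hf) :
    ∀ᵐ a ∂P, condDistrib X (fun b => f (U b)) P (f (U a)) = κ (f (U a)) :=
  ae_of_ae_map (hf.comp hU).aemeasurable
    (condDistrib_ae_eq_of_measure_eq_compProd _ hX.aemeasurable
      (map_eq_compProd_of_comap hU hX hf hlaw))

/-- Exactness of the two-step update: if `κ` is the conditional law of `W` given `(R, X)` and `η`
that of `X` given `(R, W)`, then moving `X` by `κ` and `η` preserves its conditional law given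
`R`. -/
theorem condDistrib_bind_twoStep [StandardBorelSpace γ] [Nonempty γ]
    {P : Measure Ω} [IsProbabilityMeasure P]
    {R : Ω → α} {X : Ω → γ} {W : Ω → β} (hR : Measurable R) (hX : Measurable X)
    (hW : Measurable W) {κ : Kernel (α × γ) β} [IsMarkovKernel κ] {η : Kernel (α × β) γ}
    [IsMarkovKernel η]
    (hκ : P.map (fun a => ((R a, X a), W a)) = P.map (fun a => (R a, X a)) ⊗ₘ κ)
    (hη : P.map (fun a => ((R a, W a), X a)) = P.map (fun a => (R a, W a)) ⊗ₘ η) :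
    ∀ᵐ a ∂P, (condDistrib X R P (R a)).bind
        (fun x => (κ (R a, x)).bind fun y => η (R a, y)) = condDistrib X R P (R a) := by
  let step : Kernel (α × γ) γ := (η.comap (fun p : (α × γ) × β => (p.1.1, p.2)) (by fun_prop)) ∘ₖ
    (Kernel.id ×ₖ κ)
  have hstep : ∀ r x, step (r, x) = (κ (r, x)).bind fun y => η (r, y) := by
    intro r x
    refine Measure.ext_of_lintegral _ fun F hF => ?_
    rw [Kernel.lintegral_comp _ _ _ hF, Kernel.lintegral_prod _ _ _ (by fun_prop),
      Kernel.id_apply, lintegral_dirac' _ (by fun_prop),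
      Measure.lintegral_bind (by fun_prop) hF.aemeasurable]
    rfl
  let new : Kernel α γ := step ∘ₖ (Kernel.id ×ₖ condDistrib X R P)
  have hnew : ∀ r, new r = (condDistrib X R P r).bind
      (fun x => (κ (r, x)).bind fun y => η (r, y)) := by
    intro r
    refine Measure.ext_of_lintegral _ fun F hF => ?_
    simp_rw [← hstep]
    rw [Kernel.lintegral_comp _ _ _ hF, Kernel.lintegral_prod _ _ _ (by fun_prop),
      Kernel.id_apply, lintegral_dirac' _ (by fun_prop),
      Measure.lintegral_bind (by fun_prop) hF.aemeasurable]
  -- The updated kernel disintegrates the same joint law, so uniqueness identifies it with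
  -- `condDistrib X R P`.
  have hlaw : P.map (fun a => (R a, X a)) = P.map R ⊗ₘ new := by
    refine Measure.ext_of_lintegral _ fun F hF => ?_
    rw [Measure.lintegral_compProd hF]
    have e1 : ∀ r, ∫⁻ x, F (r, x) ∂new r =
        ∫⁻ x, ∫⁻ y, ∫⁻ x', F (r, x') ∂η (r, y) ∂κ (r, x) ∂condDistrib X R P r := by
      intro r
      have hFr : Measurable fun x => F (r, x) := by fun_prop
      simp_rw [hnew, ← hstep]
      rw [Measure.lintegral_bind (by fun_prop) hFr.aemeasurable]
      simp_rw [hstep]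
      refine lintegral_congr fun x => ?_
      rw [Measure.lintegral_bind (by fun_prop) hFr.aemeasurable]
    simp_rw [e1]
    have hg : Measurable fun p : α × β => ∫⁻ x', F (p.1, x') ∂η p :=
      Measurable.lintegral_kernel_prod_right (κ := η)
        (f := fun (p : α × β) x' => F (p.1, x')) (by fun_prop)
    have hg2 : Measurable fun p : α × γ => ∫⁻ y, ∫⁻ x', F (p.1, x') ∂η (p.1, y) ∂κ p :=
      Measurable.lintegral_kernel_prod_right (κ := κ)
        (f := fun (p : α × γ) y => ∫⁻ x', F (p.1, x') ∂η (p.1, y))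
        (hg.comp (f := fun q : (α × γ) × β => (q.1.1, q.2)) (by fun_prop))
    have hg3 : Measurable fun p : (α × γ) × β => ∫⁻ x', F (p.1.1, x') ∂η (p.1.1, p.2) :=
      hg.comp (f := fun q : (α × γ) × β => (q.1.1, q.2)) (by fun_prop)
    -- The update is unwound from its end: redraw `X` given `(R, W)`, then `W` given `(R, X)`, then
    -- `X` given `R`.
    calc ∫⁻ p, F p ∂P.map (fun a => (R a, X a))
        = ∫⁻ a, F (R a, X a) ∂P := lintegral_map hF (by fun_prop)
      _ = ∫⁻ p, F (p.1.1, p.2) ∂P.map (fun a => ((R a, W a), X a)) := by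
          rw [lintegral_map (by fun_prop) (by fun_prop)]
      _ = ∫⁻ p, ∫⁻ x', F (p.1, x') ∂η p ∂P.map (fun a => (R a, W a)) := by
          rw [hη, Measure.lintegral_compProd (by fun_prop)]
      _ = ∫⁻ p, ∫⁻ x', F (p.1.1, x') ∂η (p.1.1, p.2) ∂P.map (fun a => ((R a, X a), W a)) := by
          rw [lintegral_map hg (by fun_prop), lintegral_map hg3 (by fun_prop)]
      _ = ∫⁻ p, ∫⁻ y, ∫⁻ x', F (p.1, x') ∂η (p.1, y) ∂κ p ∂P.map (fun a => (R a, X a)) := by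
          rw [hκ, Measure.lintegral_compProd hg3]
      _ = _ := by
          rw [← compProd_map_condDistrib hX.aemeasurable, Measure.lintegral_compProd hg2]
  have := ae_of_ae_map hR.aemeasurable
    (condDistrib_ae_eq_of_measure_eq_compProd R hX.aemeasurable hlaw)
  filter_upwards [this] with a ha
  rw [← hnew, ← ha]

/-- Conditional law from a joint density that factorizes. -/
theorem map_withDensity_eq_compProd {E : Type*} [MeasurableSpace E] {β₀ : Measure E}
    {ν : Measure α} [SFinite ν] {lam : Measure γ} [SFinite lam] {T : E → α} {X : E → γ}
    (hpres : MeasurePreserving (fun e => (T e, X e)) β₀ (ν.prod lam))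
    {D : E → ℝ≥0∞} {K : α → ℝ≥0∞} (hK : Measurable K)
    {q : α → γ → ℝ≥0∞} (hq : Measurable (Function.uncurry q))
    {κ : Kernel α γ} [IsSFiniteKernel κ]
    (hκ : ∀ᵐ t ∂ν, κ t = lam.withDensity (q t))
    (hD : ∀ᵐ e ∂β₀, D e = K (T e) * q (T e) (X e)) :
    (β₀.withDensity D).map (fun e => (T e, X e)) = (ν.withDensity K) ⊗ₘ κ := by
  refine Measure.ext_of_lintegral _ fun F hF => ?_
  have hq' : ∀ t, Measurable (q t) := fun t => hq.comp (by fun_prop : Measurable fun x => (t, x))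
  have hKq : Measurable fun e => K (T e) * q (T e) (X e) :=
    (hK.comp (measurable_fst.comp hpres.measurable)).mul (hq.comp hpres.measurable)
  have hFTX : Measurable fun e => F (T e, X e) := hF.comp hpres.measurable
  rw [lintegral_map hF hpres.measurable, withDensity_congr_ae hD,
    lintegral_withDensity_eq_lintegral_mul _ hKq hFTX]
  have e : ∀ e, ((fun e => K (T e) * q (T e) (X e)) * fun a => F (T a, X a)) e =
      (fun p : α × γ => K p.1 * (q p.1 p.2 * F p)) (T e, X e) := fun e => by
    simp [mul_assoc]
  refine (lintegral_congr e).trans ?_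
  have hmeas : Measurable fun p : α × γ => q p.1 p.2 * F p := hq.mul hF
  have hmeas' : Measurable fun p : α × γ => K p.1 * (q p.1 p.2 * F p) :=
    (hK.comp measurable_fst).mul hmeas
  rw [hpres.lintegral_comp hmeas', lintegral_prod _ hmeas'.aemeasurable,
    Measure.lintegral_compProd hF, lintegral_withDensity_eq_lintegral_mul _ hK (by fun_prop)]
  refine lintegral_congr_ae ?_
  filter_upwards [hκ] with t ht
  have hmt : Measurable fun x => q t x * F (t, x) := (hq' t).mul (by fun_prop)
  rw [Pi.mul_apply, lintegral_const_mul _ hmt,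
    ht, lintegral_withDensity_eq_lintegral_mul _ (hq' t) (by fun_prop)]
  rfl

end Kernels

/-! ### Measurability of the model's functions -/

section Measurability

variable {α : Type*} [MeasurableSpace α]

theorem measurable_matrix_det {ι : Type*} [Fintype ι] [DecidableEq ι] {M : α → Matrix ι ι ℝ}
    (hM : ∀ i j, Measurable fun a => M a i j) : Measurable fun a => (M a).det := by
  simp_rw [Matrix.det_apply]
  exact Finset.measurable_sum _ fun σ _ => by
    refine Measurable.const_smul ?_ _
    exact Finset.measurable_prod _ fun i _ => hM _ _

/-- The formula by determinant and adjugate also covers singular matrices, since `0⁻¹ = 0`. -/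
theorem measurable_matrix_inv {ι : Type*} [Fintype ι] [DecidableEq ι] {M : α → Matrix ι ι ℝ}
    (hM : ∀ i j, Measurable fun a => M a i j) (i j : ι) : Measurable fun a => (M a)⁻¹ i j := by
  simp_rw [Matrix.inv_def, Matrix.smul_apply, Ring.inverse_eq_inv', Matrix.adjugate_apply,
    smul_eq_mul]
  refine (measurable_matrix_det hM).inv.mul (measurable_matrix_det fun k l => ?_)
  simp only [Matrix.updateRow_apply]
  split_ifs
  · fun_prop
  · exact hM _ _

theorem measurable_dotProduct {ι : Type*} [Fintype ι] {u v : α → ι → ℝ}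
    (hu : ∀ i, Measurable fun a => u a i) (hv : ∀ i, Measurable fun a => v a i) :
    Measurable fun a => u a ⬝ᵥ v a :=
  Finset.measurable_sum _ fun i _ => (hu i).mul (hv i)

theorem measurable_mulVec {ι : Type*} [Fintype ι] {M : α → Matrix ι ι ℝ} {v : α → ι → ℝ}
    (hM : ∀ i j, Measurable fun a => M a i j) (hv : ∀ i, Measurable fun a => v a i) (i : ι) :
    Measurable fun a => (M a *ᵥ v a) i :=
  measurable_dotProduct (hM i) hv

theorem measurable_areaMean {I d : ℕ} (G : SimpleGraph (Fin I))
    {m : α → G.ConnectedComponent → Fin d → ℝ} (hm : Measurable m) (i : Fin I) (k : Fin d) :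
    Measurable fun a => areaMean G (m a) i k := by
  unfold areaMean; fun_prop

variable {I d : ℕ} (G : SimpleGraph (Fin I)) [DecidableRel G.Adj] {ρ : α → ℝ}
  {S : α → Fin d → Fin d → ℝ} {m : α → G.ConnectedComponent → Fin d → ℝ}
  {w : α → Fin I → Fin d → ℝ}

theorem measurable_extWeight {v : α → Fin d → ℝ} (hv : Measurable v) (k : Fin (d + 1)) :
    Measurable fun a => extWeight (v a) k := by
  induction k using Fin.lastCases with
  | last => simp [extWeight_last]
  | cast k => simp_rw [extWeight_castSucc]; fun_prop

theorem measurable_offset {v : α → Fin d → ℝ} (hv : Measurable v) (h : Fin d) :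
    Measurable fun a => offset h (v a) := by
  unfold offset
  have := measurable_extWeight hv
  fun_prop

theorem measurable_alrInv {v : α → Fin d → ℝ} (hv : Measurable v) (k : Fin (d + 1)) :
    Measurable fun a => alrInv (v a) k := by
  unfold alrInv
  have := measurable_extWeight hv
  fun_prop

theorem measurable_carScale (hρ : Measurable ρ) (i : Fin I) :
    Measurable fun a => carScale G (ρ a) i := by
  unfold carScale; fun_prop

theorem measurable_mcarPDF (hρ : Measurable ρ) (hS : Measurable S) (hm : Measurable m)
    (hw : Measurable w) :
    Measurable fun a => mcarPDF G (ρ a) (Matrix.of (S a)) (m a) (w a) := by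
  have hQ : ∀ p q, Measurable fun a => mcarPrecision G (ρ a) (Matrix.of (S a)) p q := by
    intro p q
    simp only [mcarPrecision, Matrix.kroneckerMap_apply, Matrix.sub_apply, Matrix.diagonal_apply,
      Matrix.smul_apply, smul_eq_mul]
    refine Measurable.mul (Measurable.sub ?_ (by fun_prop))
      (measurable_matrix_inv (fun i j => by simp only [Matrix.of_apply]; fun_prop) _ _)
    split_ifs
    · exact measurable_carScale G hρ _
    · fun_prop
  have hx : ∀ p : Fin I × Fin d,
      Measurable fun a => w a p.1 p.2 - areaMean G (m a) p.1 p.2 := fun p =>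
    Measurable.sub (by fun_prop) (measurable_areaMean G hm _ _)
  exact ((measurable_matrix_det hQ).div_const _).sqrt.mul
    (((measurable_dotProduct hx (measurable_mulVec hQ hx)).neg.div_const 2).exp)

theorem measurable_condMean (hρ : Measurable ρ) (hm : Measurable m) (hw : Measurable w)
    (i : Fin I) (k : Fin d) : Measurable fun a => condMean G (ρ a) (m a) (w a) i k := by
  unfold condMean
  have := measurable_areaMean G hm i k
  have := measurable_carScale G hρ i
  fun_prop

theorem measurable_sigmaStar (hρ : Measurable ρ) (hS : Measurable S) (i : Fin I) (h : Fin d) :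
    Measurable fun a => sigmaStar G (ρ a) (Matrix.of (S a)) i h := by
  unfold sigmaStar
  refine (measurable_carScale G hρ i).inv.mul (Measurable.sub (by simp only [Matrix.of_apply]; fun_prop)
    (measurable_dotProduct (fun k => by simp only [Matrix.of_apply]; fun_prop)
      (measurable_mulVec (measurable_matrix_inv fun k l => ?_)
        fun k => by simp only [Matrix.of_apply]; fun_prop)))
  simp only [Matrix.submatrix_apply, Matrix.of_apply]
  fun_prop

theorem measurable_muStar (hρ : Measurable ρ) (hS : Measurable S) (hm : Measurable m)
    (hw : Measurable w) (i : Fin I) (h : Fin d) :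
    Measurable fun a => muStar G (ρ a) (Matrix.of (S a)) (m a) (w a) i h := by
  unfold muStar
  have hc := measurable_condMean G hρ hm hw i
  refine (hc h).add
    (measurable_dotProduct (fun k => by simp only [Matrix.of_apply]; fun_prop)
      (measurable_mulVec (measurable_matrix_inv fun k l => ?_)
        fun k => Measurable.sub (by fun_prop) (hc k)))
  simp only [Matrix.submatrix_apply, Matrix.of_apply]
  fun_prop

theorem measurable_allocCount {n : ℕ} (h : Fin d) :
    Measurable fun s : Fin n → Fin (d + 1) => allocCount h s := measurable_of_finite _

theorem measurable_sigmaHat (hρ : Measurable ρ) (hS : Measurable S) (i : Fin I) (h : Fin d)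
    {ω : α → ℝ} (hω : Measurable ω) :
    Measurable fun a => sigmaHat G (ρ a) (Matrix.of (S a)) i h (ω a) := by
  unfold sigmaHat
  have := measurable_sigmaStar G hρ hS i h
  fun_prop

theorem measurable_muHat (hρ : Measurable ρ) (hS : Measurable S) (hm : Measurable m)
    (hw : Measurable w) (i : Fin I) (h : Fin d) {n : ℕ} {s : α → Fin n → Fin (d + 1)}
    (hs : Measurable s) {ω : α → ℝ} (hω : Measurable ω) :
    Measurable fun a => muHat G (ρ a) (Matrix.of (S a)) (m a) (w a) i h (s a) (ω a) := by
  unfold muHat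
  have := measurable_sigmaStar G hρ hS i h
  have := measurable_muStar G hρ hS hm hw i h
  have := measurable_offset (hw.eval (a := i)) h
  have : Measurable fun a => (allocCount h (s a) : ℝ) :=
    (measurable_from_top (f := fun k : ℕ => (k : ℝ))).comp ((measurable_allocCount h).comp hs)
  fun_prop

theorem measurable_gaussHat (hρ : Measurable ρ) (hS : Measurable S) (hm : Measurable m)
    (hw : Measurable w) (i : Fin I) (h : Fin d) {n : ℕ} {s : α → Fin n → Fin (d + 1)}
    (hs : Measurable s) {ω : α → ℝ} (hω : Measurable ω) :
    Measurable fun a => gaussHat G (ρ a) (Matrix.of (S a)) (m a) (w a) i h (s a) (ω a) :=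
  measurable_gaussianReal.comp ((measurable_muHat G hρ hS hm hw i h hs hω).prodMk
    (measurable_sigmaHat G hρ hS i h hω).real_toNNReal)

theorem measurable_prod_alrInv {N : Fin I → ℕ} {s : α → (i : Fin I) → Fin (N i) → Fin (d + 1)}
    (hw : Measurable w) (hs : Measurable s) :
    Measurable fun a => ∏ i, ∏ j, alrInv (w a i) (s a i j) := by
  -- The index is itself random; it is countable, so measurability for each fixed index suffices.
  have h : Measurable fun p : Fin (d + 1) × (Fin d → ℝ) => alrInv p.2 p.1 :=
    measurable_from_prod_countable_right fun k => measurable_alrInv measurable_id k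
  exact Finset.measurable_prod _ fun i _ => Finset.measurable_prod _ fun j _ =>
    h.comp (f := fun a => (s a i j, w a i)) (by fun_prop)

/-- The allocation count cancels in the quotient, which is why nothing is asked of `s`. -/
theorem measurable_pgFactor_div {n : ℕ} {s : α → Fin n → Fin (d + 1)} {v : α → Fin d → ℝ}
    {ω : α → ℝ} (hv : Measurable v) (hω : Measurable ω) (h : Fin d) :
    Measurable fun a => pgFactor (allocCount h (s a)) n (v a h - offset h (v a)) (ω a) /
      logisticLik (allocCount h (s a)) n (v a h - offset h (v a)) := by
  simp_rw [pgFactor_div_logisticLik (allocCount_le h _)]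
  have := measurable_offset hv h
  fun_prop

theorem measurable_prod_gaussianPDFReal {N : Fin I → ℕ}
    {s : α → (i : Fin I) → Fin (N i) → Fin (d + 1)} {τ : α → Fin (d + 1) → ℝ × ℝ≥0}
    {y : α → (i : Fin I) → Fin (N i) → ℝ}
    (hs : Measurable s) (hτ : Measurable τ) (hy : Measurable y) :
    Measurable fun a => ∏ i, ∏ j,
      gaussianPDFReal (τ a (s a i j)).1 (τ a (s a i j)).2 (y a i j) := by
  have h : Measurable fun p : Fin (d + 1) × (Fin (d + 1) → ℝ × ℝ≥0) × ℝ =>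
      gaussianPDFReal (p.2.1 p.1).1 (p.2.1 p.1).2 p.2.2 := by
    refine measurable_from_prod_countable_right fun k => ?_
    simp only [gaussianPDFReal]
    fun_prop
  exact Finset.measurable_prod _ fun i _ => Finset.measurable_prod _ fun j _ =>
    h.comp (f := fun a => (s a i j, τ a, y a i j)) (by fun_prop)

end Measurability

/-! ### Separating one weight from the others -/

section Split

variable {I d : ℕ}

/-- The array of transformed weights with prescribed entry at `(i, h)` and prescribed other
entries. -/
def fillWeights (i : Fin I) (h : Fin d) (r : {p : Fin I × Fin d // p ≠ (i, h)} → ℝ) (x : ℝ) :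
    Fin I → Fin d → ℝ :=
  fun j k => if hp : (j, k) = (i, h) then x else r ⟨(j, k), hp⟩

theorem fillWeights_self (i : Fin I) (h : Fin d) (r : {p : Fin I × Fin d // p ≠ (i, h)} → ℝ)
    (x : ℝ) : fillWeights i h r x i h = x := by simp [fillWeights]

theorem otherWeights_fillWeights (i : Fin I) (h : Fin d)
    (r : {p : Fin I × Fin d // p ≠ (i, h)} → ℝ) (x : ℝ) :
    otherWeights i h (fillWeights i h r x) = r := by
  funext p
  simp only [otherWeights, fillWeights]
  rw [dif_neg p.2]

theorem fillWeights_otherWeights (i : Fin I) (h : Fin d) (w : Fin I → Fin d → ℝ) :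
    fillWeights i h (otherWeights i h w) (w i h) = w := by
  funext j k
  simp only [otherWeights, fillWeights]
  split_ifs with hp
  · obtain ⟨rfl, rfl⟩ := Prod.mk.inj hp
    rfl
  · rfl

theorem measurable_otherWeights (i : Fin I) (h : Fin d) :
    Measurable (otherWeights i h : (Fin I → Fin d → ℝ) → _) := by
  unfold otherWeights; fun_prop

theorem measurable_fillWeights {α : Type*} [MeasurableSpace α] (i : Fin I) (h : Fin d)
    {r : α → {p : Fin I × Fin d // p ≠ (i, h)} → ℝ} {x : α → ℝ} (hr : Measurable r)
    (hx : Measurable x) : Measurable fun a => fillWeights i h (r a) (x a) := by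
  refine measurable_pi_lambda _ fun j => measurable_pi_lambda _ fun k => ?_
  simp only [fillWeights]
  split_ifs <;> fun_prop

theorem measurePreserving_uncurry_volume {ι κ : Type*} [Fintype ι] [Fintype κ] :
    MeasurePreserving (fun (w : ι → κ → ℝ) (p : ι × κ) => w p.1 p.2) volume volume := by
  refine ⟨by fun_prop, ?_⟩
  refine (Measure.pi_eq fun s hs => ?_).symm
  rw [Measure.map_apply (by fun_prop) (MeasurableSet.univ_pi hs)]
  have : (fun (w : ι → κ → ℝ) (p : ι × κ) => w p.1 p.2) ⁻¹' Set.univ.pi s =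
      Set.univ.pi fun i => Set.univ.pi fun k => s (i, k) := by
    ext w; simp [Set.mem_pi]
  rw [this, volume_pi_pi, Fintype.prod_prod_type]
  exact Finset.prod_congr rfl fun i _ => volume_pi_pi _

/-- Lebesgue measure splits as the product over one entry and all the others. -/
theorem measurePreserving_otherWeights_entry (i : Fin I) (h : Fin d) :
    MeasurePreserving (fun w : Fin I → Fin d → ℝ => (otherWeights i h w, w i h)) volume
      (volume.prod volume) := by
  have h1 := measurePreserving_uncurry_volume (ι := Fin I) (κ := Fin d)
  have h2 := volume_preserving_piEquivPiSubtypeProd (fun _ : Fin I × Fin d => ℝ)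
    (fun p => p ≠ (i, h))
  rw [Measure.volume_eq_prod] at h2
  -- The complementary block has a single index, so Lebesgue measure on it is that of `ℝ`.
  let : Unique {p : Fin I × Fin d // ¬p ≠ (i, h)} :=
    { default := ⟨(i, h), by simp⟩
      uniq := fun p => Subtype.ext (not_not.1 p.2) }
  have h3 := volume_preserving_funUnique {p : Fin I × Fin d // ¬p ≠ (i, h)} ℝ
  refine MeasurePreserving.comp
    (g := Prod.map id (MeasurableEquiv.funUnique {p : Fin I × Fin d // ¬p ≠ (i, h)} ℝ))
    ((MeasurePreserving.id _).prod ?_) (h2.comp h1)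
  convert h3 <;> rfl

end Split

/-! ### Disintegration of the augmented law -/

section Laws

variable {I d : ℕ}

theorem measurable_pgTilt {α : Type*} [MeasurableSpace α] (b : ℝ) {c x : α → ℝ}
    (hc : Measurable c) (hx : Measurable x) : Measurable fun a => pgTilt b (c a) (x a) := by
  unfold pgTilt; fun_prop

/-- By tilting, the whole family has densities, jointly measurable in the parameter, against the one
measure `PG(b, 0)`. -/
theorem measurable_polyaGamma {α : Type*} [MeasurableSpace α] {b : ℝ} (hb : 0 < b) {c : α → ℝ}
    (hc : Measurable c) : Measurable fun a => polyaGamma b (c a) := by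
  have := isProbabilityMeasure_polyaGamma hb 0
  have hm : Measurable (Function.uncurry fun (a : α) x => pgTilt b (c a) x) :=
    measurable_pgTilt b (by fun_prop) (by fun_prop)
  have : (fun a => polyaGamma b (c a)) =
      (Kernel.const α (polyaGamma b 0)).withDensity fun a x => pgTilt b (c a) x := by
    funext a
    rw [Kernel.withDensity_apply _ hm, Kernel.const_apply, polyaGamma_eq_withDensity hb (c a)]
  rw [this]
  exact Kernel.measurable _

/-- The conditional law of the Pólya–Gamma variable given the transformed weights of the area. -/
noncomputable def pgKernel {n : ℕ} (hn : 0 < n) (h : Fin d) : Kernel (Fin d → ℝ) ℝ where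
  toFun v := polyaGamma n (v h - offset h v)
  measurable' := measurable_polyaGamma (Nat.cast_pos.2 hn)
    (Measurable.sub (by fun_prop) (measurable_offset measurable_id h))

instance {n : ℕ} (hn : 0 < n) (h : Fin d) : IsMarkovKernel (pgKernel hn h) :=
  ⟨fun _ => isProbabilityMeasure_polyaGamma (Nat.cast_pos.2 hn) _⟩

variable (G : SimpleGraph (Fin I)) {N : Fin I → ℕ}
  (prior : Measure (Hyper G d)) [IsProbabilityMeasure prior]
  (P₀ : Measure (ℝ × ℝ≥0)) [IsProbabilityMeasure P₀]

/-- The reference measure of the model. -/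
noncomputable def modelBase (N : Fin I → ℕ) : Measure (ModelState G d N) :=
  prior.prod (volume.prod (Measure.count.prod ((Measure.pi fun _ => P₀).prod volume)))

instance : SFinite (modelBase G prior P₀ N) := by
  unfold modelBase; exact Measure.prod.instSFinite

instance [DecidableRel G.Adj] : SFinite (modelLaw G N prior P₀) := by
  change SFinite ((modelBase G prior P₀ N).withDensity _)
  infer_instance

/-- In the augmented model, `ω_ih` has conditional law `PG(N_i, η_ih)`. -/
theorem augmentedLaw_eq_compProd [DecidableRel G.Adj] (i : Fin I) (h : Fin d) (hN : 0 < N i) :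
    augmentedLaw G N prior P₀ i h = modelLaw G N prior P₀ ⊗ₘ
      (pgKernel hN h).comap (fun x : ModelState G d N => x.2.1 i) (by fun_prop) := by
  have hb : (0 : ℝ) < N i := Nat.cast_pos.2 hN
  have := isProbabilityMeasure_polyaGamma hb 0
  have hη : Measurable fun x : ModelState G d N => x.2.1 i h - offset h (x.2.1 i) :=
    Measurable.sub (by fun_prop) (measurable_offset (by fun_prop) h)
  -- The density ratio is already a probability density in `ω`, so nothing is left for the other
  -- variables: `K = 1`.
  have key := map_withDensity_eq_compProd (β₀ := (modelLaw G N prior P₀).prod (polyaGamma (N i) 0))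
    (T := Prod.fst) (X := Prod.snd) (MeasurePreserving.id _) (K := 1)
    (D := fun x => pgTilt (N i) (x.1.2.1 i h - offset h (x.1.2.1 i)) x.2) measurable_one
    (q := fun x ω => pgTilt (N i) (x.2.1 i h - offset h (x.2.1 i)) ω)
    (measurable_pgTilt _ (hη.comp measurable_fst) measurable_snd)
    (κ := (pgKernel hN h).comap (fun x : ModelState G d N => x.2.1 i) (by fun_prop))
    (ae_of_all _ fun x => polyaGamma_eq_withDensity hb _)
    (ae_of_all _ fun x => by simp)
  rw [withDensity_one] at key
  rw [← key]
  refine Eq.trans ?_ Measure.map_id.symm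
  unfold augmentedLaw
  congr 1
  funext x
  rw [pgTilt, ← pgFactor_div_logisticLik (allocCount_le h (x.1.2.2.1 i))]

/-- The conditional law of `w̃_ih` in the augmented model, as a function of the variables it
depends on. -/
noncomputable def gaussKernel [DecidableRel G.Adj] (i : Fin I) (h : Fin d) (n : ℕ) :
    Kernel (ℝ × (Fin d → Fin d → ℝ) × (G.ConnectedComponent → Fin d → ℝ) ×
      ({p : Fin I × Fin d // p ≠ (i, h)} → ℝ) × (Fin n → Fin (d + 1)) × ℝ) ℝ where
  -- The entry `(i, h)` is filled with the arbitrary value `0`, on which `gaussHat` does not depend.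
  toFun t := gaussHat G t.1 (Matrix.of t.2.1) t.2.2.1 (fillWeights i h t.2.2.2.1 0) i h
    t.2.2.2.2.1 t.2.2.2.2.2
  measurable' := measurable_gaussHat G (by fun_prop) (by fun_prop) (by fun_prop)
    (measurable_fillWeights i h (by fun_prop) (by fun_prop)) i h (by fun_prop) (by fun_prop)

instance [DecidableRel G.Adj] (i : Fin I) (h : Fin d) (n : ℕ) : IsMarkovKernel (gaussKernel G i h n) :=
  ⟨fun _ => by change IsProbabilityMeasure (gaussianReal _ _); infer_instance⟩

theorem measurePreserving_prod_right_comm {α β γ : Type*} [MeasurableSpace α] [MeasurableSpace β]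
    [MeasurableSpace γ] (μ : Measure α) (ν : Measure β) (ξ : Measure γ) [SFinite μ] [SFinite ν]
    [SFinite ξ] :
    MeasurePreserving (fun p : (α × β) × γ => ((p.1.1, p.2), p.1.2)) ((μ.prod ν).prod ξ)
      ((μ.prod ξ).prod ν) := by
  refine ⟨by fun_prop, Measure.ext_of_lintegral _ fun F hF => ?_⟩
  rw [lintegral_map hF (by fun_prop), lintegral_prod _ (by fun_prop), lintegral_prod _ (by fun_prop),
    lintegral_prod _ hF.aemeasurable, lintegral_prod _ (by fun_prop)]
  refine lintegral_congr fun a => ?_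
  rw [lintegral_lintegral_swap]
  fun_prop

/-- All variables of the augmented model other than `w̃_ih`. -/
abbrev RestState (d : ℕ) (N : Fin I → ℕ) (i : Fin I) (h : Fin d) : Type :=
  ((Hyper G d × ({p : Fin I × Fin d // p ≠ (i, h)} → ℝ)) ×
    (((i : Fin I) → Fin (N i) → Fin (d + 1)) × (Fin (d + 1) → ℝ × ℝ≥0) ×
      ((i : Fin I) → Fin (N i) → ℝ))) × ℝ

/-- The variables other than `w̃_ih`, as a function of the state of the augmented model. -/
def restState (i : Fin I) (h : Fin d) (e : ModelState G d N × ℝ) : RestState G d N i h :=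
  (((e.1.1, otherWeights i h e.1.2.1), e.1.2.2), e.2)

/-- The variables on which the full conditional of `w̃_ih` depends. -/
def gaussArgs (i : Fin I) (h : Fin d) (t : RestState G d N i h) :
    ℝ × (Fin d → Fin d → ℝ) × (G.ConnectedComponent → Fin d → ℝ) ×
      ({p : Fin I × Fin d // p ≠ (i, h)} → ℝ) × (Fin (N i) → Fin (d + 1)) × ℝ :=
  (t.1.1.1.1, t.1.1.1.2.1, t.1.1.1.2.2, t.1.1.2, t.1.2.1 i, t.2)

theorem measurable_gaussArgs (i : Fin I) (h : Fin d) :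
    Measurable (gaussArgs G (N := N) i h) := by
  unfold gaussArgs; fun_prop

/-- The reference measure for the variables other than `w̃_ih`. -/
noncomputable def restBase (N : Fin I → ℕ) (i : Fin I) (h : Fin d) :
    Measure (RestState G d N i h) :=
  ((prior.prod volume).prod (Measure.count.prod ((Measure.pi fun _ => P₀).prod volume))).prod
    (polyaGamma (N i) 0)

/-- Moving `w̃_ih` to the last place exhibits the reference measure as a product with Lebesgue
measure, as `map_withDensity_eq_compProd` requires. -/
theorem measurePreserving_restState (i : Fin I) (h : Fin d) [SFinite (polyaGamma (N i) 0)] :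
    MeasurePreserving (fun e : ModelState G d N × ℝ => (restState G i h e, e.1.2.1 i h))
      ((modelBase G prior P₀ N).prod (polyaGamma (N i) 0))
      ((restBase G prior P₀ N i h).prod volume) := by
  let U : Measure (((i : Fin I) → Fin (N i) → Fin (d + 1)) × (Fin (d + 1) → ℝ × ℝ≥0) ×
      ((i : Fin I) → Fin (N i) → ℝ)) := Measure.count.prod ((Measure.pi fun _ => P₀).prod volume)
  have h1 : MeasurePreserving (fun e : ModelState G d N =>
      ((e.1, (otherWeights i h e.2.1, e.2.1 i h)), e.2.2)) (modelBase G prior P₀ N)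
      ((prior.prod (volume.prod volume)).prod U) := by
    have a := (MeasurePreserving.id prior).prod
      ((measurePreserving_otherWeights_entry i h).prod (MeasurePreserving.id U))
    exact (measurePreserving_prodAssoc prior _ U).symm.comp a
  have h2 : MeasurePreserving (fun e : ModelState G d N =>
      (((e.1, otherWeights i h e.2.1), e.2.1 i h), e.2.2)) (modelBase G prior P₀ N)
      (((prior.prod volume).prod volume).prod U) :=
    ((measurePreserving_prodAssoc prior _ _).symm.prod (MeasurePreserving.id U)).comp h1
  have h3 : MeasurePreserving (fun e : ModelState G d N =>
      (((e.1, otherWeights i h e.2.1), e.2.2), e.2.1 i h)) (modelBase G prior P₀ N)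
      (((prior.prod volume).prod U).prod volume) :=
    (measurePreserving_prod_right_comm _ _ _).comp h2
  exact (measurePreserving_prod_right_comm _ _ _).comp
    (h3.prod (MeasurePreserving.id (polyaGamma (N i) 0)))

end Laws

/-! ### Full conditional of one weight -/

section FullConditional

variable {I d : ℕ} (G : SimpleGraph (Fin I)) [DecidableRel G.Adj] {N : Fin I → ℕ}
  (prior : Measure (Hyper G d)) 
  (P₀ : Measure (ℝ × ℝ≥0))

/-- The density of the augmented model with respect to the reference measure. -/
noncomputable def augmentedDensity (i : Fin I) (h : Fin d) (e : ModelState G d N × ℝ) : ℝ≥0∞ :=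
  ENNReal.ofReal (weightDensity G e.1.1.1 (Matrix.of e.1.1.2.1) e.1.1.2.2 i h e.1.2.2.1 e.2
    e.1.2.1 * ∏ i, ∏ j, gaussianPDFReal (e.1.2.2.2.1 (e.1.2.2.1 i j)).1
      (e.1.2.2.2.1 (e.1.2.2.1 i j)).2 (e.1.2.2.2.2 i j))

theorem measurable_weightDensity {α : Type*} [MeasurableSpace α] {ρ : α → ℝ}
    {S : α → Fin d → Fin d → ℝ} {m : α → G.ConnectedComponent → Fin d → ℝ}
    {w : α → Fin I → Fin d → ℝ} {s : α → (i : Fin I) → Fin (N i) → Fin (d + 1)} {ω : α → ℝ}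
    (hρ : Measurable ρ) (hS : Measurable S) (hm : Measurable m) (hw : Measurable w)
    (hs : Measurable s) (hω : Measurable ω) (i : Fin I) (h : Fin d) :
    Measurable fun a =>
      weightDensity G (ρ a) (Matrix.of (S a)) (m a) i h (s a) (ω a) (w a) :=
  (measurable_mcarPDF G hρ hS hm hw).mul ((measurable_prod_alrInv hw hs).mul
    (measurable_pgFactor_div (s := fun a => s a i) (hw.eval (a := i)) hω h))

theorem augmentedLaw_eq_withDensity (i : Fin I) (h : Fin d) [SFinite (polyaGamma (N i) 0)] :
    augmentedLaw G N prior P₀ i h = ((modelBase G prior P₀ N).prod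
      (polyaGamma (N i) 0)).withDensity (augmentedDensity G i h) := by
  have hf : Measurable fun x : ModelState G d N => ENNReal.ofReal
      (mcarPDF G x.1.1 (Matrix.of x.1.2.1) x.1.2.2 x.2.1 *
        (∏ i, ∏ j, alrInv (x.2.1 i) (x.2.2.1 i j)) *
        ∏ i, ∏ j, gaussianPDFReal (x.2.2.2.1 (x.2.2.1 i j)).1 (x.2.2.2.1 (x.2.2.1 i j)).2
          (x.2.2.2.2 i j)) :=
    (((measurable_mcarPDF G (by fun_prop) (by fun_prop) (by fun_prop) (by fun_prop)).mul
      (measurable_prod_alrInv (by fun_prop) (by fun_prop))).mul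
      (measurable_prod_gaussianPDFReal (by fun_prop) (by fun_prop) (by fun_prop))).ennreal_ofReal
  have hg : Measurable fun x : ModelState G d N × ℝ => ENNReal.ofReal
      (pgFactor (allocCount h (x.1.2.2.1 i)) (N i) (x.1.2.1 i h - offset h (x.1.2.1 i)) x.2 /
        logisticLik (allocCount h (x.1.2.2.1 i)) (N i) (x.1.2.1 i h - offset h (x.1.2.1 i))) :=
    (measurable_pgFactor_div (s := fun x : ModelState G d N × ℝ => x.1.2.2.1 i)
      (by fun_prop) (by fun_prop) h).ennreal_ofReal
  change (((modelBase G prior P₀ N).withDensity _).prod (polyaGamma (N i) 0)).withDensity _ = _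
  rw [prod_withDensity_left hf]
  refine (withDensity_mul _ (hf.comp measurable_fst) hg).symm.trans ?_
  congr 1
  funext x
  rw [augmentedDensity, weightDensity, Pi.mul_apply, Function.comp_apply,
    ← ENNReal.ofReal_mul' (div_nonneg (pgFactor_pos _ _ _ _).le (logisticLik_pos _ _ _).le)]
  congr 1
  ring

/-- In the augmented model, `w̃_ih` has conditional law `N(μ̂_ih, Σ̂_ih)`. -/
theorem exists_map_augmentedLaw_eq_compProd [IsProbabilityMeasure prior]
    [IsProbabilityMeasure P₀]
    (hprior : ∀ᵐ θ ∂prior, θ.1 ∈ Set.Ioo (0 : ℝ) 1 ∧ (Matrix.of θ.2.1).PosDef)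
    (i : Fin I) (h : Fin d) (hN : 0 < N i) :
    ∃ ξ : Measure (RestState G d N i h), SFinite ξ ∧
      (augmentedLaw G N prior P₀ i h).map (fun e => (restState G i h e, e.1.2.1 i h)) =
        ξ ⊗ₘ (gaussKernel G i h (N i)).comap (gaussArgs G i h) (measurable_gaussArgs G i h) := by
  have hb : (0 : ℝ) < N i := Nat.cast_pos.2 hN
  have := isProbabilityMeasure_polyaGamma hb 0
  let M : RestState G d N i h → ℝ := fun t => muHat G t.1.1.1.1 (Matrix.of t.1.1.1.2.1)
    t.1.1.1.2.2 (fillWeights i h t.1.1.2 0) i h (t.1.2.1 i) t.2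
  let V : RestState G d N i h → ℝ≥0 := fun t =>
    (sigmaHat G t.1.1.1.1 (Matrix.of t.1.1.1.2.1) i h t.2).toNNReal
  have hfill : Measurable fun t : RestState G d N i h => fillWeights i h t.1.1.2 0 :=
    measurable_fillWeights i h (by fun_prop) (by fun_prop)
  have hM : Measurable M := measurable_muHat G (by fun_prop) (by fun_prop) (by fun_prop) hfill i h
    (by fun_prop) (by fun_prop)
  have hV : Measurable V :=
    (measurable_sigmaHat G (by fun_prop) (by fun_prop) i h (by fun_prop)).real_toNNReal
  have hφ : Measurable fun p : RestState G d N i h × ℝ =>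
      gaussianPDFReal (M p.1) (V p.1) p.2 := by
    simp only [gaussianPDFReal]
    fun_prop
  have hφ₀ : Measurable fun t => gaussianPDFReal (M t) (V t) 0 := by
    simp only [gaussianPDFReal]
    fun_prop
  -- The factor of proportionality between joint density and Gaussian density, read off at the value
  -- `0` of `w̃_ih`.
  let K : RestState G d N i h → ℝ≥0∞ := fun t => ENNReal.ofReal
    (weightDensity G t.1.1.1.1 (Matrix.of t.1.1.1.2.1) t.1.1.1.2.2 i h t.1.2.1 t.2
      (fillWeights i h t.1.1.2 0) / gaussianPDFReal (M t) (V t) 0 *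
      ∏ i, ∏ j, gaussianPDFReal (t.1.2.2.1 (t.1.2.1 i j)).1 (t.1.2.2.1 (t.1.2.1 i j)).2
        (t.1.2.2.2 i j))
  have hK : Measurable K := by
    have h₁ : Measurable fun t : RestState G d N i h =>
        weightDensity G t.1.1.1.1 (Matrix.of t.1.1.1.2.1) t.1.1.1.2.2 i h t.1.2.1 t.2
          (fillWeights i h t.1.1.2 0) :=
      measurable_weightDensity G (by fun_prop) (by fun_prop) (by fun_prop) hfill (by fun_prop)
        (by fun_prop) i h
    have h₂ : Measurable fun t : RestState G d N i h =>
        ∏ i, ∏ j, gaussianPDFReal (t.1.2.2.1 (t.1.2.1 i j)).1 (t.1.2.2.1 (t.1.2.1 i j)).2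
          (t.1.2.2.2 i j) :=
      measurable_prod_gaussianPDFReal (by fun_prop) (by fun_prop) (by fun_prop)
    exact ((h₁.div hφ₀).mul h₂).ennreal_ofReal
  -- Off this set the variance might vanish and the Gaussian would have no density.
  have hregular : ∀ᵐ t ∂restBase G prior P₀ N i h,
      (t.1.1.1.1 ∈ Set.Ioo (0 : ℝ) 1 ∧ (Matrix.of t.1.1.1.2.1).PosDef) ∧ 0 ≤ t.2 := by
    unfold restBase
    refine (Measure.quasiMeasurePreserving_fst.ae (Measure.quasiMeasurePreserving_fst.ae
      (Measure.quasiMeasurePreserving_fst.ae hprior))).and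
      (Measure.quasiMeasurePreserving_snd.ae (ae_nonneg_polyaGamma hb 0))
  have hpres := measurePreserving_restState G prior P₀ (N := N) i h
  have hVne : ∀ {t : RestState G d N i h},
      (t.1.1.1.1 ∈ Set.Ioo (0 : ℝ) 1 ∧ (Matrix.of t.1.1.1.2.1).PosDef) ∧ 0 ≤ t.2 → V t ≠ 0 :=
    fun ht => (Real.toNNReal_pos.2 (sigmaHat_pos G ht.1.1 ht.1.2 i h ht.2)).ne'
  have hregular' : ∀ᵐ e ∂(modelBase G prior P₀ N).prod (polyaGamma (N i) 0),
      (e.1.1.1 ∈ Set.Ioo (0 : ℝ) 1 ∧ (Matrix.of e.1.1.2.1).PosDef) ∧ 0 ≤ e.2 :=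
    hpres.quasiMeasurePreserving.ae (Measure.quasiMeasurePreserving_fst.ae hregular)
  refine ⟨(restBase G prior P₀ N i h).withDensity K, ?_, ?_⟩
  · have : SFinite (restBase G prior P₀ N i h) := by
      unfold restBase; exact Measure.prod.instSFinite
    infer_instance
  rw [augmentedLaw_eq_withDensity]
  have : SFinite (restBase G prior P₀ N i h) := by
    unfold restBase; exact Measure.prod.instSFinite
  refine map_withDensity_eq_compProd hpres hK (q := fun t x => gaussianPDF (M t) (V t) x)
    hφ.ennreal_ofReal ?_ ?_
  · filter_upwards [hregular] with t ht
    exact gaussianReal_of_var_ne_zero _ (hVne ht)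
  · filter_upwards [hregular'] with e he
    have hw : otherWeights i h (fillWeights i h (otherWeights i h e.1.2.1) 0) =
        otherWeights i h e.1.2.1 := otherWeights_fillWeights _ _ _ _
    have key := weightDensity_mul_gaussianPDFReal G he.1.1 he.1.2 e.1.1.2.2 hw e.1.2.2.1 he.2
    rw [fillWeights_self] at key
    have hpos := gaussianPDFReal_pos (M (restState G i h e)) (V (restState G i h e)) 0
      (hVne (t := restState G i h e) he)
    rw [augmentedDensity, gaussianPDF, ← ENNReal.ofReal_mul' (gaussianPDFReal_nonneg _ _ _)]
    congr 1
    change _ = weightDensity G e.1.1.1 (Matrix.of e.1.1.2.1) e.1.1.2.2 i h e.1.2.2.1 e.2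
      (fillWeights i h (otherWeights i h e.1.2.1) 0) /
        gaussianPDFReal (M (restState G i h e)) (V (restState G i h e)) 0 *
      (∏ i, ∏ j, gaussianPDFReal (e.1.2.2.2.1 (e.1.2.2.1 i j)).1
        (e.1.2.2.2.1 (e.1.2.2.1 i j)).2 (e.1.2.2.2.2 i j)) *
      gaussianPDFReal (M (restState G i h e)) (V (restState G i h e)) (e.1.2.1 i h)
    rw [eq_div_of_mul_eq hpos.ne' key.symm]
    change _ * gaussianPDFReal (M (restState G i h e)) (V (restState G i h e)) (e.1.2.1 i h) /
      _ * _ = _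
    ring

end FullConditional

/-! ### The main theorem -/

/-- All variables of the original model other than `w̃_ih`. -/
abbrev ModelRest {I : ℕ} (G : SimpleGraph (Fin I)) (d : ℕ) (N : Fin I → ℕ) (i : Fin I)
    (h : Fin d) : Type :=
  ℝ × (Fin d → Fin d → ℝ) × (G.ConnectedComponent → Fin d → ℝ) ×
    ({p : Fin I × Fin d // p ≠ (i, h)} → ℝ) × ((i : Fin I) → Fin (N i) → Fin (d + 1)) ×
    (Fin (d + 1) → ℝ × ℝ≥0) × ((i : Fin I) → Fin (N i) → ℝ)

theorem mainTheorem3 {I d : ℕ} (G : SimpleGraph (Fin I)) [DecidableRel G.Adj] (N : Fin I → ℕ)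
    (prior : Measure (Hyper G d)) [IsProbabilityMeasure prior]
    (hprior : ∀ᵐ θ ∂prior, θ.1 ∈ Set.Ioo (0 : ℝ) 1 ∧ (Matrix.of θ.2.1).PosDef)
    (P₀ : Measure (ℝ × ℝ≥0)) [IsProbabilityMeasure P₀] (hP₀ : ∀ᵐ t ∂P₀, 0 < t.2)
    (i : Fin I) (h : Fin d) (hN : 0 < N i)
    {Ω : Type*} [MeasurableSpace Ω] (P : Measure Ω) [IsProbabilityMeasure P]
    (ρ : Ω → ℝ) (S : Ω → Fin d → Fin d → ℝ) (m : Ω → G.ConnectedComponent → Fin d → ℝ)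
    (w : Ω → Fin I → Fin d → ℝ) (s : Ω → (i : Fin I) → Fin (N i) → Fin (d + 1))
    (τ : Ω → Fin (d + 1) → ℝ × ℝ≥0) (y : Ω → (i : Fin I) → Fin (N i) → ℝ) (ω : Ω → ℝ)
    (hρ : Measurable ρ) (hS : Measurable S) (hm : Measurable m) (hw : Measurable w)
    (hs : Measurable s) (hτ : Measurable τ) (hy : Measurable y) (hω : Measurable ω)
    (hlaw : P.map (fun a => (((ρ a, S a, m a), w a, s a, τ a, y a), ω a)) =
      augmentedLaw G N prior P₀ i h) :
    -- the augmentation does not change the law of the original model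
    P.map (fun a => ((ρ a, S a, m a), w a, s a, τ a, y a)) = modelLaw G N prior P₀ ∧
    -- full conditional of the transformed weight, given `ω_ih` and everything else
    (∀ᵐ a ∂P,
      condDistrib (fun b => w b i h)
        (fun b => (ρ b, S b, m b, otherWeights i h (w b), s b, τ b, y b, ω b)) P
        (ρ a, S a, m a, otherWeights i h (w a), s a, τ a, y a, ω a) =
      gaussHat G (ρ a) (Matrix.of (S a)) (m a) (w a) i h (s a i) (ω a)) ∧
    -- the same law, given only the variables it depends on
    (∀ᵐ a ∂P,
      condDistrib (fun b => w b i h)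
        (fun b => (ρ b, S b, m b, otherWeights i h (w b), s b i, ω b)) P
        (ρ a, S a, m a, otherWeights i h (w a), s a i, ω a) =
      gaussHat G (ρ a) (Matrix.of (S a)) (m a) (w a) i h (s a i) (ω a)) ∧
    -- full conditional of `ω_ih`, given everything else
    (∀ᵐ a ∂P,
      condDistrib ω (fun b => (ρ b, S b, m b, w b, s b, τ b, y b)) P
        (ρ a, S a, m a, w a, s a, τ a, y a) =
      polyaGamma (N i) (w a i h - offset h (w a i))) ∧
    -- the same law, given only the transformed weights of area `i`
    (∀ᵐ a ∂P,
      condDistrib ω (fun b => w b i) P (w a i) =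
      polyaGamma (N i) (w a i h - offset h (w a i))) ∧
    -- the two-step update leaves the full conditional of `w̃_ih` in the original model invariant
    (∀ᵐ a ∂P,
      (condDistrib (fun b => w b i h)
        (fun b => (ρ b, S b, m b, otherWeights i h (w b), s b, τ b, y b)) P
        (ρ a, S a, m a, otherWeights i h (w a), s a, τ a, y a)).bind
          (twoStepUpdate G (ρ a) (Matrix.of (S a)) (m a) (w a) i h (s a i)) =
      condDistrib (fun b => w b i h)
        (fun b => (ρ b, S b, m b, otherWeights i h (w b), s b, τ b, y b)) P
        (ρ a, S a, m a, otherWeights i h (w a), s a, τ a, y a)) := by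
  have hU : Measurable fun a => ((ρ a, S a, m a), w a, s a, τ a, y a) := by fun_prop
  have hother := measurable_otherWeights i h
  have hwih : Measurable fun a => w a i h := by fun_prop
  have hrest : Measurable fun a =>
      restState G i h (((ρ a, S a, m a), w a, s a, τ a, y a), ω a) := by
    unfold restState; fun_prop
  have hpg := hlaw.trans (augmentedLaw_eq_compProd G prior P₀ i h hN)
  obtain ⟨ξ, _, hξ⟩ := exists_map_augmentedLaw_eq_compProd G prior P₀ hprior i h hN
  have hgauss : P.map (fun a => (restState G i h (((ρ a, S a, m a), w a, s a, τ a, y a), ω a),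
      w a i h)) = ξ ⊗ₘ (gaussKernel G i h (N i)).comap (gaussArgs G i h)
        (measurable_gaussArgs G i h) := by
    rw [← hξ, ← hlaw, Measure.map_map _ (by fun_prop)]
    · rfl
    · unfold restState; fun_prop
  have hcongr : ∀ a, gaussHat G (ρ a) (Matrix.of (S a)) (m a)
      (fillWeights i h (otherWeights i h (w a)) 0) i h (s a i) (ω a) =
      gaussHat G (ρ a) (Matrix.of (S a)) (m a) (w a) i h (s a i) (ω a) := fun a =>
    gaussHat_congr G _ _ _ (otherWeights_fillWeights _ _ _ _) _ _
  refine ⟨?_, ?_, ?_, ?_, ?_, ?_⟩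
  · have := congrArg Measure.fst hpg
    rwa [Measure.fst_compProd, Measure.fst_map_prodMk hω] at this
  · have := condDistrib_ae_eq_of_comap hrest hwih
      (κ := (gaussKernel G i h (N i)).comap
        (fun t : ℝ × (Fin d → Fin d → ℝ) × (G.ConnectedComponent → Fin d → ℝ) ×
          ({p : Fin I × Fin d // p ≠ (i, h)} → ℝ) × ((i : Fin I) → Fin (N i) → Fin (d + 1)) ×
          (Fin (d + 1) → ℝ × ℝ≥0) × ((i : Fin I) → Fin (N i) → ℝ) × ℝ =>
          (t.1, t.2.1, t.2.2.1, t.2.2.2.1, t.2.2.2.2.1 i, t.2.2.2.2.2.2.2)) (by fun_prop))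
      (f := fun t => (t.1.1.1.1, t.1.1.1.2.1, t.1.1.1.2.2, t.1.1.2, t.1.2.1, t.1.2.2.1, t.1.2.2.2,
        t.2)) (by fun_prop) hgauss
    filter_upwards [this] with a ha
    exact ha.trans (hcongr a)
  · have := condDistrib_ae_eq_of_comap hrest hwih (measurable_gaussArgs G i h) hgauss
    filter_upwards [this] with a ha
    exact ha.trans (hcongr a)
  · exact condDistrib_ae_eq_of_comap hU hω
      (κ := (pgKernel hN h).comap
        (fun t : ℝ × (Fin d → Fin d → ℝ) × (G.ConnectedComponent → Fin d → ℝ) ×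
          (Fin I → Fin d → ℝ) × ((i : Fin I) → Fin (N i) → Fin (d + 1)) ×
          (Fin (d + 1) → ℝ × ℝ≥0) × ((i : Fin I) → Fin (N i) → ℝ) => t.2.2.2.1 i) (by fun_prop))
      (f := fun x => (x.1.1, x.1.2.1, x.1.2.2, x.2.1, x.2.2.1, x.2.2.2.1, x.2.2.2.2))
      (by fun_prop) hpg
  · exact condDistrib_ae_eq_of_comap hU hω (κ := pgKernel hN h) (f := fun x => x.2.1 i)
      (by fun_prop) hpg
  · have hfill : Measurable fun p : ModelRest G d N i h × ℝ => fillWeights i h p.1.2.2.2.1 p.2 :=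
      measurable_fillWeights i h (by fun_prop) (by fun_prop)
    -- `κ` draws `ω` given the rest and the current entry, `η` the new entry given the rest and `ω`;
    -- composed, they are `twoStepUpdate`.
    let κ : Kernel (ModelRest G d N i h × ℝ) ℝ := (pgKernel hN h).comap
      (fun p => fillWeights i h p.1.2.2.2.1 p.2 i) (by fun_prop)
    let η : Kernel (ModelRest G d N i h × ℝ) ℝ := (gaussKernel G i h (N i)).comap
      (fun p => (p.1.1, p.1.2.1, p.1.2.2.1, p.1.2.2.2.1, p.1.2.2.2.2.1 i, p.2)) (by fun_prop)
    have hκ := map_eq_compProd_of_comap hU hω (κ := κ)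
      (f := fun x => ((x.1.1, x.1.2.1, x.1.2.2, otherWeights i h x.2.1, x.2.2.1, x.2.2.2.1,
        x.2.2.2.2), x.2.1 i h)) (by fun_prop) (ξ := modelLaw G N prior P₀) (by
        rw [hpg]
        congr 1
        ext1 x
        simp only [κ, Kernel.comap_apply, fillWeights_otherWeights])
    have hη := map_eq_compProd_of_comap hrest hwih (κ := η)
      (f := fun t => ((t.1.1.1.1, t.1.1.1.2.1, t.1.1.1.2.2, t.1.1.2, t.1.2.1, t.1.2.2.1,
        t.1.2.2.2), t.2)) (by fun_prop) hgauss
    have hR : Measurable fun a => (ρ a, S a, m a, otherWeights i h (w a), s a, τ a, y a) := by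
      fun_prop
    filter_upwards [condDistrib_bind_twoStep hR hwih hω hκ hη] with a ha
    refine Eq.trans ?_ ha
    congr 1
    funext x
    have hw : otherWeights i h (fillWeights i h (otherWeights i h (w a)) x) =
        otherWeights i h (w a) := otherWeights_fillWeights _ _ _ _
    have e₁ : κ ((ρ a, S a, m a, otherWeights i h (w a), s a, τ a, y a), x) =
        polyaGamma (N i) (x - offset h (w a i)) := by
      change polyaGamma (N i) (fillWeights i h (otherWeights i h (w a)) x i h -
        offset h (fillWeights i h (otherWeights i h (w a)) x i)) = _
      rw [fillWeights_self, offset_congr (entry_eq_of_otherWeights_eq hw)]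
    rw [twoStepUpdate, e₁]
    congr 1
    funext z
    exact (gaussHat_congr G _ _ _ (otherWeights_fillWeights _ _ _ _) _ _).symm
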